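/- Let $\mathcal H$ be a complex Hilbert space, $T$ an anti-unitary operator on $\mathcal H$ with $T^2=-\mathrm{Id}$, $n\ge 0$ an integer, $\mathbb T=\mathbb R/2\pi\mathbb Z$, and $\mathrm{Proj}_{2n}(\mathcal H)$ the set of orthogonal projections of rank $2n$ on $\mathcal H$; continuity of operator-valued maps is with respect to the operator norm. A continuous map $P:\mathbb T^2\to \mathrm{Proj}_{2n}(\mathcal H)$ is called time-reversal symmetric if $TP(k)=P(-k)T$ for all $k\in\mathbb T^2$. The invariant $\delta(P)$ of such a map is defined as follows. Choose - a continuous unitary-valued map $U:[-\pi,\pi]\times\mathbb T\to\mathcal U(\mathcal H)$ with $P(t,k)U(t,k)=U(t,k)P(0,0)$ and $TU(t,k)=U(-t,-k)T$ for all $t\in[-\pi,\pi]$, $k\in\mathbb T$; - an orthonormal basis $u_1,\dots,u_{2n}$ of $\operatorname{Im}P(0,0)$ with $u_{n+j}=Tu_j$ for $1\le j\le n$. Put $u_j(t,k)=U(t,k)u_j$ and define matrices $\alpha(k)\in U(2n)$ by $u_j(-\pi,k)=\sum_{a=1}^{2n}\alpha(k)_{j,a}\,u_a(\pi,k)$.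 With $J=\begin{pmatrix}0&\mathrm{Id}_n\\-\mathrm{Id}_n&0\end{pmatrix}$, choose further - $\gamma_0,\gamma_\pi\in U(2n)$ with $\alpha(0)=J\gamma_0^tJ^{-1}\gamma_0$ and $\alpha(\pi)=J\gamma_\pi^tJ^{-1}\gamma_\pi$; - real numbers $\lambda_0,\lambda_\pi$ with $\det\gamma_0=e^{i\lambda_0}$ and $\det\gamma_\pi=e^{i\lambda_\pi}$; - a continuous $\mu:[0,\pi]\to\mathbb R$ with $\det\alpha(k)=e^{i\mu(k)}$ for $k\in[0,\pi]$ and $\mu(0)=2\lambda_0$. Then $$\delta(P)=\exp\Big(i\,\frac{2\lambda_\pi-\mu(\pi)}{2}\Big).$$ **Proposition.** Let $P_0,P_1:\mathbb T^2\to\mathrm{Proj}_{2n}(\mathcal H)$ be continuous time-reversal symmetric maps. Suppose that they are symmetrically unitarily equivalent, i.e. there is a continuous $U:\mathbb T^2\to\mathcal U(\mathcal H)$ with $TU(k)=U(-k)T$ and $P_1(k)=U(k)P_0(k)U(k)^{-1}$ for all $k\in\mathbb T^2$; or that they are symmetrically homotopic, i.e. there is a continuous $P:[0,1]\times\mathbb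 T^2\to\mathrm{Proj}_{2n}(\mathcal H)$ with $P(0,k)=P_0(k)$, $P(1,k)=P_1(k)$ and $TP(t,k)=P(t,-k)T$ for all $t\in[0,1]$, $k\in\mathbb T^2$. Then $\delta(P_0)$ and $\delta(P_1)$ are well defined (choices as above exist, and the result does not depend on them), they lie in $\{1,-1\}$, and $\delta(P_0)=\delta(P_1)$. -/

import Mathlib

noncomputable section

namespace TimeReversal

variable {H : Type*} [NormedAddCommGroup H] [InnerProductSpace ℂ H] [CompleteSpace H]

/-- The two-dimensional torus `(ℝ / 2πℤ)²`. -/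
abbrev Torus2 : Type := Real.Angle × Real.Angle

/-- `Proj_m(H)`: the orthogonal projections of rank `m` (equality of cardinals, so an operator of
infinite rank never qualifies). It carries the topology of the operator norm. -/
def Proj (H : Type*) [NormedAddCommGroup H] [InnerProductSpace ℂ H] [CompleteSpace H] (m : ℕ) :
    Set (H →L[ℂ] H) :=
  {p | IsStarProjection p ∧ LinearMap.rank (p : H →ₗ[ℂ] H) = (m : Cardinal)}

/-- `P : 𝕋² → Proj_m(H)` is continuous and `T P(k) = P(-k) T`. -/
structure IsTRSymmetric (T : H ≃ₗᵢ⋆[ℂ] H) (m : ℕ) (P : Torus2 → H →L[ℂ] H) : Prop where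
  continuous : Continuous P
  mem_proj : ∀ k, P k ∈ Proj H m
  symm : ∀ k x, T (P k x) = P (-k) (T x)

/-- Symmetric unitary equivalence: `T U(k) = U(-k) T` and `P₁(k) = U(k) P₀(k) U(k)⁻¹`. -/
def SymmUnitarilyEquivalent (T : H ≃ₗᵢ⋆[ℂ] H) (P₀ P₁ : Torus2 → H →L[ℂ] H) : Prop :=
  ∃ U : Torus2 → unitary (H →L[ℂ] H), Continuous U ∧
    (∀ k x, T ((U k : H →L[ℂ] H) x) = (U (-k) : H →L[ℂ] H) (T x)) ∧
    ∀ k, P₁ k = (U k : H →L[ℂ] H) * P₀ k * ((U k)⁻¹ : unitary (H →L[ℂ] H))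

/-- Symmetric homotopy: a jointly continuous `P : [0,1] × 𝕋² → Proj_m(H)` from `P₀` to `P₁`
with `T P(t,k) = P(t,-k) T`. -/
def SymmHomotopic (T : H ≃ₗᵢ⋆[ℂ] H) (m : ℕ) (P₀ P₁ : Torus2 → H →L[ℂ] H) : Prop :=
  ∃ P : unitInterval × Torus2 → H →L[ℂ] H, Continuous P ∧ (∀ q, P q ∈ Proj H m) ∧
    (∀ k, P (0, k) = P₀ k) ∧ (∀ k, P (1, k) = P₁ k) ∧
    ∀ t k x, T (P (t, k) x) = P (t, -k) (T x)

/-- `J = (0 1; -1 0)` in `n × n` blocks. -/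
def symplecticJ (n : ℕ) : Matrix (Fin n ⊕ Fin n) (Fin n ⊕ Fin n) ℂ :=
  Matrix.fromBlocks 0 1 (-1) 0

/-- All the choices that enter the construction of `δ(P)`. -/
structure DeltaChoice (T : H ≃ₗᵢ⋆[ℂ] H) (n : ℕ) (P : Torus2 → H →L[ℂ] H) where
  /-- A norm continuous unitary-valued map on `[-π,π] × 𝕋¹`, periodic in the second variable only
  (values at `t ∉ [-π,π]` are irrelevant). -/
  U : ℝ → Real.Angle → unitary (H →L[ℂ] H)
  continuousOn_U : ContinuousOn (fun q : ℝ × Real.Angle => U q.1 q.2)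
    (Set.Icc (-Real.pi) Real.pi ×ˢ Set.univ)
  intertwines : ∀ t ∈ Set.Icc (-Real.pi) Real.pi, ∀ k : Real.Angle,
    P ((t : Real.Angle), k) * (U t k : H →L[ℂ] H) = (U t k : H →L[ℂ] H) * P (0, 0)
  symm : ∀ t ∈ Set.Icc (-Real.pi) Real.pi, ∀ (k : Real.Angle) (x : H),
    T ((U t k : H →L[ℂ] H) x) = (U (-t) (-k) : H →L[ℂ] H) (T x)
  /-- A quaternionic orthonormal basis of the range of `P(0,0)`. -/
  u : Fin n ⊕ Fin n → H
  orthonormal : Orthonormal ℂ u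
  span_u : Submodule.span ℂ (Set.range u) = LinearMap.range (P (0, 0) : H →ₗ[ℂ] H)
  u_inr : ∀ j, u (Sum.inr j) = T (u (Sum.inl j))
  /-- The matching matrices: `u_j(-π,k) = ∑ₐ α(k)_{j,a} u_a(π,k)` with `u_j(t,k) = U(t,k) u_j`. -/
  α : Real.Angle → Matrix (Fin n ⊕ Fin n) (Fin n ⊕ Fin n) ℂ
  matching : ∀ (k : Real.Angle) (j : Fin n ⊕ Fin n),
    (U (-Real.pi) k : H →L[ℂ] H) (u j) = ∑ a, α k j a • (U Real.pi k : H →L[ℂ] H) (u a)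
  γ₀ : Matrix (Fin n ⊕ Fin n) (Fin n ⊕ Fin n) ℂ
  γπ : Matrix (Fin n ⊕ Fin n) (Fin n ⊕ Fin n) ℂ
  γ₀_unitary : γ₀ ∈ Matrix.unitaryGroup (Fin n ⊕ Fin n) ℂ
  γπ_unitary : γπ ∈ Matrix.unitaryGroup (Fin n ⊕ Fin n) ℂ
  α_zero : α 0 = symplecticJ n * γ₀.transpose * (symplecticJ n)⁻¹ * γ₀
  α_pi : α (Real.pi : Real.Angle) = symplecticJ n * γπ.transpose * (symplecticJ n)⁻¹ * γπ
  lam₀ : ℝ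
  lamπ : ℝ
  det_γ₀ : γ₀.det = Complex.exp (Complex.I * lam₀)
  det_γπ : γπ.det = Complex.exp (Complex.I * lamπ)
  /-- A continuous phase of `det α` on `[0,π]`, normalised at `0` by `λ₀`. -/
  μ : ℝ → ℝ
  continuousOn_μ : ContinuousOn μ (Set.Icc 0 Real.pi)
  det_α : ∀ k ∈ Set.Icc (0 : ℝ) Real.pi,
    (α (k : Real.Angle)).det = Complex.exp (Complex.I * μ k)
  μ_zero : μ 0 = 2 * lam₀

/-- The number `exp (i (2 λ_π - μ(π)) / 2)` obtained from a system of choices. -/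
def DeltaChoice.value {T : H ≃ₗᵢ⋆[ℂ] H} {n : ℕ} {P : Torus2 → H →L[ℂ] H}
    (D : DeltaChoice T n P) : ℂ :=
  Complex.exp (Complex.I * ((2 * D.lamπ - D.μ Real.pi) / 2))

/-- All values that the construction of `δ(P)` can produce. -/
def deltaValues (T : H ≃ₗᵢ⋆[ℂ] H) (n : ℕ) (P : Torus2 → H →L[ℂ] H) : Set ℂ :=
  Set.range (DeltaChoice.value : DeltaChoice T n P → ℂ)

open Classical in
/-- The invariant `δ(P)`, computed from some system of choices (`0` if there were none). -/
def delta (T : H ≃ₗᵢ⋆[ℂ] H) (n : ℕ) (P : Torus2 → H →L[ℂ] H) : ℂ :=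
  if h : Nonempty (DeltaChoice T n P) then h.some.value else 0

end TimeReversal

end

/-! Existence rests on a transport that respects every symmetry. For projections with `‖q - p‖ < 1`,
the principal root of `(2q-1)(2p-1)` carries `p` to `q` (`mul_carrier`). Being built by functional
calculus, it commutes with conjugation by `T` (`IsPhaseMap.map_carrier`). Products of such roots
along a fine subdivision give symmetric transports. All of them differ from `1` by a finite rank
operator, so a holonomy has finite spectrum, hence a spectral gap, hence a logarithm compatible with
`T` and with the projection (`exists_log`). This logarithm closes up the frame over the circle `t =
0`, and its half yields the factor `γ` at the fixed points `k = 0, π` (`exists_selfdual_factor`).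

For independence, two systems of choices differ by a unitary change of frames `G(t,k)` with `J
G(-t,-k) = conj(G(t,k)) J`. At `t = 0`, `k = 0, π` it is unitary and symplectic, so its determinant
is `1` rather than merely a sign. Reflection symmetry then forces the phase of `det G` to change by
an even multiple of `2π` around each circle `t = const`. Thus `2λ_π - μ(π)` changes by a multiple of
`4π`, and its half by a multiple of `2π` (`DeltaChoice.value_unique`).

The value is a sign because `det α(π) = (det γ_π)²`. A symmetric equivalence transports all choices
with the same `α`, so it preserves the value. A homotopy becomes an equivalence by transport along
its parameter (`SymmHomotopic.symmUnitarilyEquivalent`). -/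

noncomputable section

namespace TimeReversal

section

open Complex Metric NormedSpace selfAdjoint Unitary
open scoped Real

/-! ### Logarithms and roots of unitaries, and their naturality. -/

section CStar

variable {A : Type*} [CStarAlgebra A]

/-- The selfadjoint argument of an element, by continuous functional calculus. -/
def phaseArg (a : A) : selfAdjoint A := ⟨cfc (arg · : ℂ → ℂ) a, .cfc_arg a⟩

/-- The principal square root of a unitary element. -/
def phaseRoot (a : A) : unitary A := expUnitary ((1 / 2 : ℝ) • phaseArg a)

lemma expUnitary_phaseArg {a : A} (ha : a ∈ unitary A) (h : ‖a - 1‖ < 2) :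
    (expUnitary (phaseArg a) : A) = a :=
  congrArg Subtype.val (expUnitary_argSelfAdjoint (u := ⟨a, ha⟩) h)

lemma norm_phaseArg_lt {a : A} (ha : a ∈ unitary A) (h : ‖a - 1‖ < 2) : ‖phaseArg a‖ < π := by
  have := (Unitary.openPartialHomeomorph (A := A)).map_source' (x := ⟨a, ha⟩)
    (by simpa [Subtype.dist_eq, dist_eq_norm] using h)
  rw [← mem_ball_zero_iff]
  exact this

lemma phaseArg_eq_of_expUnitary {a : A} {x : selfAdjoint A} (hx : ‖x‖ < π)
    (h : (expUnitary x : A) = a) : phaseArg a = x := by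
  subst h
  exact argSelfAdjoint_expUnitary hx

lemma expUnitary_half_mul_self (x : selfAdjoint A) :
    expUnitary ((1 / 2 : ℝ) • x) * expUnitary ((1 / 2 : ℝ) • x) = expUnitary x := by
  rw [← Commute.expUnitary_add (Commute.refl _), ← add_smul]
  norm_num

lemma phaseRoot_mul_self {a : A} (ha : a ∈ unitary A) (h : ‖a - 1‖ < 2) :
    (phaseRoot a * phaseRoot a : A) = a := by
  have := congrArg Subtype.val (expUnitary_half_mul_self (phaseArg a))
  rw [expUnitary_phaseArg ha h] at this
  exact this

lemma expUnitary_neg (x : selfAdjoint A) : expUnitary (-x) = star (expUnitary x) := by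
  have h : expUnitary (-x) * expUnitary x = 1 := by
    rw [← Commute.expUnitary_add (by simp)]; simp
  rw [Unitary.star_eq_inv]
  exact eq_inv_of_mul_eq_one_left h

lemma phaseArg_star {a : A} (ha : a ∈ unitary A) (h : ‖a - 1‖ < 2) :
    phaseArg (star a) = -phaseArg a := by
  refine phaseArg_eq_of_expUnitary (by simpa using norm_phaseArg_lt ha h) ?_
  rw [expUnitary_neg, Unitary.coe_star, expUnitary_phaseArg ha h]

lemma phaseRoot_star {a : A} (ha : a ∈ unitary A) (h : ‖a - 1‖ < 2) :
    phaseRoot (star a) = star (phaseRoot a) := by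
  rw [phaseRoot, phaseArg_star ha h, smul_neg, expUnitary_neg, phaseRoot]

/-- Keeps `-1` out of the spectrum of the root, so that the root plus `1` is invertible. -/
lemma norm_phaseRoot_sub_one_lt {a : A} (ha : a ∈ unitary A) (h : ‖a - 1‖ < 2) :
    ‖(phaseRoot a - 1 : A)‖ < 2 :=
  (Unitary.norm_expUnitary_smul_argSelfAdjoint_sub_one_le ⟨a, ha⟩
    (t := 1 / 2) (by norm_num) h).trans_lt h

lemma continuousOn_phaseRoot_comp {Y : Type*} [TopologicalSpace Y] {f : Y → A} {S : Set Y}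
    (hf : ContinuousOn f S) (hu : ∀ y ∈ S, f y ∈ unitary A) (h : ∀ y ∈ S, ‖f y - 1‖ < 2) :
    ContinuousOn (fun y => phaseRoot (f y)) S := by
  rw [continuousOn_iff_continuous_domRestrict] at hf ⊢
  have h1 : Continuous fun y : S => (⟨f y, hu y y.2⟩ : unitary A) := hf.subtype_mk _
  have h2 : Continuous fun y : S => Unitary.argSelfAdjoint (⟨f y, hu y y.2⟩ : unitary A) :=
    continuousOn_argSelfAdjoint.comp_continuous h1 fun y => by
      simpa [Subtype.dist_eq, dist_eq_norm] using h y y.2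
  exact continuous_expUnitary.comp (h2.const_smul (1 / 2 : ℝ))

/-- An isometric real star automorphism which is complex linear (`ε = 1`) or conjugate linear
(`ε = -1`). -/
structure IsPhaseMap (ψ : A →⋆ₐ[ℝ] A) (ε : ℝ) : Prop where
  norm_map : ∀ x, ‖ψ x‖ = ‖x‖
  map_I_smul : ∀ x, ψ (I • x) = ε • (I • ψ x)
  abs_eps : |ε| = 1

/-- The action of a star homomorphism on selfadjoint elements. -/
def mapSA (ψ : A →⋆ₐ[ℝ] A) (x : selfAdjoint A) : selfAdjoint A := ⟨ψ x, x.2.map ψ⟩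

/-- `ψ` is continuous, so it passes through the exponential series, and it turns `i` into `ε i`. -/
lemma IsPhaseMap.map_expUnitary {ψ : A →⋆ₐ[ℝ] A} {ε : ℝ} (hψ : IsPhaseMap ψ ε)
    (x : selfAdjoint A) : ψ (expUnitary x : A) = expUnitary (ε • mapSA ψ x) := by
  rw [expUnitary_coe, expUnitary_coe]
  let +nondep : NormedAlgebra ℚ A := .restrictScalars ℚ ℂ A
  have hc : Continuous ψ :=
    (AddMonoidHomClass.isometry_of_norm ψ hψ.norm_map).continuous
  rw [NormedSpace.map_exp ψ hc, hψ.map_I_smul]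
  congr 1
  simp only [selfAdjoint.val_smul, mapSA]
  rw [smul_comm]

lemma IsPhaseMap.phaseArg_map {ψ : A →⋆ₐ[ℝ] A} {ε : ℝ} (hψ : IsPhaseMap ψ ε) {a : A}
    (ha : a ∈ unitary A) (h : ‖a - 1‖ < 2) : phaseArg (ψ a) = ε • mapSA ψ (phaseArg a) := by
  refine phaseArg_eq_of_expUnitary ?_ ?_
  · rw [norm_smul, Real.norm_eq_abs, hψ.abs_eps, one_mul]
    exact (hψ.norm_map _).trans_lt (norm_phaseArg_lt ha h)
  · rw [← hψ.map_expUnitary, expUnitary_phaseArg ha h]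

/-- The sign `ε` enters the argument of `ψ a` and the image of the exponential alike, so roots are
natural even for conjugate linear maps. -/
lemma IsPhaseMap.map_phaseRoot {ψ : A →⋆ₐ[ℝ] A} {ε : ℝ} (hψ : IsPhaseMap ψ ε) {a : A}
    (ha : a ∈ unitary A) (h : ‖a - 1‖ < 2) : ψ (phaseRoot a : A) = phaseRoot (ψ a) := by
  rw [phaseRoot, phaseRoot, hψ.map_expUnitary, hψ.phaseArg_map ha h]
  congr 2
  ext
  simp [mapSA, smul_comm ε]

/-- Conjugation by a unitary. -/
def unitaryConj (s : unitary A) : A →⋆ₐ[ℝ] A where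
  toFun x := s * x * star (s : A)
  map_one' := by simp
  map_mul' x y := by
    have : star (s : A) * s = 1 := Unitary.coe_star_mul_self s
    calc _ = (s : A) * x * 1 * y * star (s : A) := by simp [mul_assoc]
      _ = _ := by rw [← this]; simp only [mul_assoc]
  map_zero' := by simp
  map_add' x y := by simp [mul_add, add_mul]
  commutes' r := by
    rw [← Algebra.commutes, mul_assoc, Unitary.mul_star_self_of_mem s.2, mul_one]
  map_star' x := by simp [mul_assoc]

lemma isPhaseMap_unitaryConj (s : unitary A) : IsPhaseMap (unitaryConj s) 1 where
  norm_map x := by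
    change ‖(s : A) * x * star (s : A)‖ = ‖x‖
    rw [CStarRing.norm_mul_mem_unitary _ (Unitary.star_mem s.2), CStarRing.norm_coe_unitary_mul]
  map_I_smul x := by simp [unitaryConj]
  abs_eps := by simp

/-! ### Transport between nearby projections. -/

/-- The reflection `2p - 1`. -/
def reflection (p : A) : A := 2 * p - 1

lemma star_reflection {p : A} (hp : IsStarProjection p) : star (reflection p) = reflection p := by
  simp [reflection, hp.isSelfAdjoint.star_eq, two_mul]

lemma reflection_mul_self {p : A} (hp : IsStarProjection p) :
    reflection p * reflection p = 1 := by
  have := hp.isIdempotentElem.eq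
  simp only [reflection, two_mul, mul_sub, sub_mul, mul_add, add_mul, this, mul_one, one_mul]
  abel

lemma reflection_mem_unitary {p : A} (hp : IsStarProjection p) : reflection p ∈ unitary A := by
  rw [Unitary.mem_iff, star_reflection hp, reflection_mul_self hp]; simp

/-- The canonical unitary that carries the projection `p` to the projection `q`. -/
def carrier (q p : A) : unitary A := phaseRoot (reflection q * reflection p)

lemma reflection_mul_mem {p q : A} (hp : IsStarProjection p) (hq : IsStarProjection q) :
    reflection q * reflection p ∈ unitary A :=
  mul_mem (reflection_mem_unitary hq) (reflection_mem_unitary hp)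

/-- Since `(2p-1)² = 1`, the difference equals `2(q-p)(2p-1)`, whose last factor is unitary. -/
lemma norm_reflection_mul_sub_one {p q : A} (hp : IsStarProjection p)
    (h : ‖q - p‖ < 1) : ‖reflection q * reflection p - 1‖ < 2 := by
  have e : reflection q * reflection p - 1 = (2 : ℝ) • ((q - p) *
      ((⟨_, reflection_mem_unitary hp⟩ : unitary A) : A)) := by
    have : (1 : A) = reflection p * reflection p := (reflection_mul_self hp).symm
    rw [this, ← sub_mul, ← smul_mul_assoc]
    congr 1
    simp [reflection, two_smul, two_mul]
    abel
  rw [e, norm_smul, CStarRing.norm_mul_coe_unitary]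
  norm_num
  linarith

/-- Conjugation by `2p-1` sends `(2q-1)(2p-1)` to its adjoint, hence its root `K` to `K*`. Combined
with `K² = (2q-1)(2p-1)` this gives `(2q-1)K = K(2p-1)`. -/
lemma mul_carrier {p q : A} (hp : IsStarProjection p) (hq : IsStarProjection q)
    (h : ‖q - p‖ < 1) : q * carrier q p = carrier q p * p := by
  have hu := reflection_mul_mem hp hq
  have hn := norm_reflection_mul_sub_one hp h
  set s : unitary A := ⟨_, reflection_mem_unitary hp⟩ with hs
  set K := carrier q p
  have hK : (K * K : A) = reflection q * reflection p := phaseRoot_mul_self hu hn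
  have h1 : (reflection p * K * reflection p : A) = star (K : A) := by
    have := (isPhaseMap_unitaryConj s).map_phaseRoot hu hn
    have e : unitaryConj s (reflection q * reflection p) = star (reflection q * reflection p) := by
      change reflection p * (reflection q * reflection p) * star (reflection p) = _
      rw [star_mul, star_reflection hp, star_reflection hq, mul_assoc, mul_assoc,
        reflection_mul_self hp, mul_one]
    rw [e, phaseRoot_star hu hn] at this
    change reflection p * K * star (reflection p) = star (K : A) at this
    rwa [star_reflection hp] at this
  have h2 : reflection q * K = K * reflection p := by
    have h3 : reflection q = K * K * reflection p := by
      rw [hK, mul_assoc, reflection_mul_self hp, mul_one]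
    calc reflection q * K = K * K * (reflection p * K * reflection p) * reflection p := by
          rw [mul_assoc, mul_assoc (reflection p * K), reflection_mul_self hp, mul_one, ← mul_assoc,
            ← h3]
      _ = K * reflection p := by
          rw [h1, mul_assoc (K : A) K, Unitary.mul_star_self_of_mem K.2, mul_one]
  simp only [reflection, sub_mul, mul_sub, one_mul, mul_one, sub_left_inj] at h2
  have h4 : (2 : ℝ) • (q * (K : A)) = (2 : ℝ) • ((K : A) * p) := by
    rw [two_smul, two_smul, ← two_mul, ← two_mul, ← mul_assoc, h2, ← mul_assoc, ← mul_assoc]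
    congr 1
    simp [two_mul, mul_two]
  exact smul_right_injective _ two_ne_zero h4

lemma IsPhaseMap.map_reflection (ψ : A →⋆ₐ[ℝ] A) (p : A) :
    ψ (reflection p) = reflection (ψ p) := by
  simp [reflection, two_mul]

lemma IsPhaseMap.map_carrier {ψ : A →⋆ₐ[ℝ] A} {ε : ℝ} (hψ : IsPhaseMap ψ ε) {p q : A}
    (hp : IsStarProjection p) (hq : IsStarProjection q) (h : ‖q - p‖ < 1) :
    ψ (carrier q p : A) = carrier (ψ q) (ψ p) := by
  rw [carrier, hψ.map_phaseRoot (reflection_mul_mem hp hq) (norm_reflection_mul_sub_one hp h),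
    map_mul, IsPhaseMap.map_reflection, IsPhaseMap.map_reflection, carrier]

lemma continuousOn_carrier_comp {Y : Type*} [TopologicalSpace Y] {f g : Y → A} {S : Set Y}
    (hf : ContinuousOn f S) (hg : ContinuousOn g S) (hfp : ∀ y ∈ S, IsStarProjection (f y))
    (hgp : ∀ y ∈ S, IsStarProjection (g y)) (h : ∀ y ∈ S, ‖f y - g y‖ < 1) :
    ContinuousOn (fun y => carrier (f y) (g y)) S := by
  refine continuousOn_phaseRoot_comp ?_ (fun y hy => reflection_mul_mem (hgp y hy) (hfp y hy))
    fun y hy => norm_reflection_mul_sub_one (hgp y hy) (h y hy)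
  unfold reflection
  fun_prop

/-- The ordered product of the canonical unitaries along a sequence of projections. -/
def chain (f : ℕ → A) : ℕ → unitary A
  | 0 => 1
  | i + 1 => carrier (f (i + 1)) (f i) * chain f i

lemma mul_chain {f : ℕ → A} (hp : ∀ i, IsStarProjection (f i)) {N : ℕ}
    (h : ∀ i < N, ‖f (i + 1) - f i‖ < 1) : f N * chain f N = chain f N * f 0 := by
  induction N with
  | zero => simp [chain]
  | succ N ih =>
    rw [chain, Submonoid.coe_mul, ← mul_assoc, mul_carrier (hp _) (hp _) (h N (by omega)),
      mul_assoc, ih fun i hi => h i (by omega), mul_assoc]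

lemma IsPhaseMap.map_chain {ψ : A →⋆ₐ[ℝ] A} {ε : ℝ} (hψ : IsPhaseMap ψ ε) {f g : ℕ → A}
    (hfg : ∀ i, ψ (f i) = g i) (hp : ∀ i, IsStarProjection (f i)) {N : ℕ}
    (h : ∀ i < N, ‖f (i + 1) - f i‖ < 1) : ψ (chain f N : A) = chain g N := by
  induction N with
  | zero => simp [chain]
  | succ N ih =>
    rw [chain, Submonoid.coe_mul, map_mul, ih fun i hi => h i (by omega),
      hψ.map_carrier (hp _) (hp _) (h N (by omega)), hfg, hfg, chain, Submonoid.coe_mul]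

lemma continuousOn_chain {Y : Type*} [TopologicalSpace Y] {f : ℕ → Y → A} {S : Set Y}
    (hf : ∀ i, ContinuousOn (f i) S) (hp : ∀ i, ∀ y ∈ S, IsStarProjection (f i y)) {N : ℕ}
    (h : ∀ i < N, ∀ y ∈ S, ‖f (i + 1) y - f i y‖ < 1) :
    ContinuousOn (fun y => chain (fun i => f i y) N) S := by
  induction N with
  | zero => exact continuousOn_const
  | succ N ih =>
    exact (continuousOn_carrier_comp (hf _) (hf _) (hp _) (hp _) (h N (by omega))).mul
      (ih fun i hi => h i (by omega))

/-! ### One-parameter groups and invariant logarithms. -/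

/-- The one-parameter group `r ↦ exp (i r L)`. -/
def rotor (L : selfAdjoint A) (r : ℝ) : unitary A := expUnitary (r • L)

lemma rotor_add (L : selfAdjoint A) (r s : ℝ) : rotor L (r + s) = rotor L r * rotor L s := by
  have hc : Commute ((r • L : selfAdjoint A) : A) ((s • L : selfAdjoint A) : A) :=
    ((Commute.refl (L : A)).smul_left r).smul_right s
  rw [rotor, add_smul, hc.expUnitary_add, rotor, rotor]

lemma rotor_one (L : selfAdjoint A) : rotor L 1 = expUnitary L := by simp [rotor]

lemma rotor_neg (L : selfAdjoint A) (r : ℝ) : rotor L (-r) = star (rotor L r) := by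
  rw [rotor, neg_smul, expUnitary_neg, rotor]

lemma continuous_rotor (L : selfAdjoint A) : Continuous (rotor L) :=
  continuous_expUnitary.comp (continuous_id.smul continuous_const)

lemma IsPhaseMap.map_rotor {ψ : A →⋆ₐ[ℝ] A} {ε : ℝ} (hψ : IsPhaseMap ψ ε) {L : selfAdjoint A}
    (hL : ψ L = L) (r : ℝ) : ψ (rotor L r : A) = rotor L (ε * r) := by
  rw [rotor, hψ.map_expUnitary, rotor, mul_smul]
  congr 3
  ext1
  simp [mapSA, hL]

lemma expUnitary_smul_one_mul (θ : ℝ) (a : A) :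
    (expUnitary (θ • (1 : selfAdjoint A)) : A) * a = cexp (I * θ) • a := by
  have : (expUnitary (θ • (1 : selfAdjoint A)) : A) = cexp (I * θ) • 1 := by
    rw [expUnitary_coe]
    have e : I • ((θ • (1 : selfAdjoint A) : selfAdjoint A) : A) = algebraMap ℂ A (I * θ) := by
      rw [Algebra.algebraMap_eq_smul_one, mul_smul]
      simp
    rw [e, ← NormedSpace.algebraMap_exp_comm, Algebra.algebraMap_eq_smul_one,
      Complex.exp_eq_exp_ℂ]
  rw [this, smul_mul_assoc, one_mul]

/-- A unitary with a gap in its spectrum has a logarithm that is invariant under the symmetries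
of the unitary. -/
lemma exists_log_of_gap (u : unitary A) {θ : ℝ} (hθ : ‖cexp (I * θ) • (u : A) - 1‖ < 2) :
    ∃ L : selfAdjoint A, expUnitary L = u ∧
      (∀ ψ : A →⋆ₐ[ℝ] A, IsPhaseMap ψ (-1) → ψ u = star (u : A) → ψ L = L) ∧
      ∀ ψ : A →⋆ₐ[ℝ] A, IsPhaseMap ψ 1 → ψ u = u → ψ L = L := by
  obtain ⟨o, ho⟩ : ∃ o : selfAdjoint A, o = θ • 1 := ⟨_, rfl⟩
  have hoc : ∀ X : A, (expUnitary o : A) * X = cexp (I * θ) • X := by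
    rw [ho]; exact expUnitary_smul_one_mul θ
  have hcomm : expUnitary o * u = u * expUnitary o := by
    ext1
    have e1 := hoc 1
    rw [mul_one] at e1
    rw [Submonoid.coe_mul, Submonoid.coe_mul, hoc, e1, mul_smul_comm, mul_one]
  obtain ⟨a, ha⟩ : ∃ a : unitary A, a = expUnitary o * u := ⟨_, rfl⟩
  have han : ‖(a : A) - 1‖ < 2 := by rwa [ha, Submonoid.coe_mul, hoc]
  have hmapo : ∀ ψ : A →⋆ₐ[ℝ] A, mapSA ψ o = o := by
    intro ψ
    ext1
    simp [mapSA, ho]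
  have hlog : ∀ ψ : A →⋆ₐ[ℝ] A, mapSA ψ (phaseArg (a : A)) = phaseArg (a : A) →
      ψ ((phaseArg (a : A) - o : selfAdjoint A) : A) = (phaseArg (a : A) - o : selfAdjoint A) := by
    intro ψ h
    have h1 := congrArg Subtype.val h
    have h2 := congrArg Subtype.val (hmapo ψ)
    simp only [mapSA] at h1 h2
    rw [AddSubgroup.coe_sub, map_sub, h1, h2]
  refine ⟨phaseArg (a : A) - o, ?_, fun ψ hψ h => hlog ψ ?_, fun ψ hψ h => hlog ψ ?_⟩
  · have hc : Commute ((phaseArg (a : A) - o : selfAdjoint A) : A) o := by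
      rw [ho]
      exact (Commute.one_right _).smul_right θ
    have h1 := hc.expUnitary_add
    rw [sub_add_cancel] at h1
    have h2 : expUnitary (phaseArg (a : A)) = a := Subtype.ext (expUnitary_phaseArg a.2 han)
    rw [h2] at h1
    rw [hcomm] at ha
    exact (mul_right_cancel (ha.symm.trans h1)).symm
  -- Here `ψ a = a*`: the sign from the adjoint cancels the sign from conjugate linearity.
  · have h1 := hψ.phaseArg_map a.2 han
    have h2 : ψ a = star (a : A) := by
      have e : ψ a = ((star (expUnitary o) * star u : unitary A) : A) := by
        rw [ha, Submonoid.coe_mul, map_mul, hψ.map_expUnitary, hmapo, neg_one_smul,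
          expUnitary_neg, h, Submonoid.coe_mul, Unitary.coe_star, Unitary.coe_star]
      rw [e, ← star_mul, ← hcomm, ha, Unitary.coe_star]
    rw [h2, phaseArg_star a.2 han, neg_one_smul, neg_inj] at h1
    exact h1.symm
  · have h1 := hψ.phaseArg_map a.2 han
    have h2 : ψ a = a := by
      rw [ha, Submonoid.coe_mul, map_mul, hψ.map_expUnitary, hmapo, one_smul, h]
    rw [h2, one_smul] at h1
    exact h1.symm

/-- Recasts commutation with a projection as invariance under a linear phase map, so that one
naturality argument covers it too. -/
lemma unitaryConj_reflection_eq_iff {p x : A} (hp : IsStarProjection p) :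
    unitaryConj ⟨_, reflection_mem_unitary hp⟩ x = x ↔ p * x = x * p := by
  change reflection p * x * star (reflection p) = x ↔ _
  rw [star_reflection hp]
  have h1 : reflection p * x * reflection p = x ↔ reflection p * x = x * reflection p := by
    constructor
    · intro h
      nth_rw 2 [← h]
      rw [mul_assoc _ (reflection p), reflection_mul_self hp, mul_one]
    · intro h
      rw [h, mul_assoc, reflection_mul_self hp, mul_one]
  rw [h1]
  simp only [reflection, sub_mul, mul_sub, one_mul, mul_one, sub_left_inj]
  have h2 : 2 * p * x = (2 : ℂ) • (p * x) := by rw [two_smul, mul_assoc, two_mul]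
  have h3 : x * (2 * p) = (2 : ℂ) • (x * p) := by rw [two_smul, two_mul, mul_add]
  rw [h2, h3]
  exact (smul_right_injective _ (two_ne_zero (α := ℂ))).eq_iff

end CStar

end

section

open Complex selfAdjoint
open scoped Real InnerProductSpace Pointwise

/-! ### Conjugation by an antiunitary operator. -/

section Antiunitary

variable {H : Type*} [NormedAddCommGroup H] [InnerProductSpace ℂ H]

/-- Polarization: `T` preserves norms and exchanges `i` with `-i`, which conjugates the formula. -/
lemma inner_antiunitary (T : H ≃ₗᵢ⋆[ℂ] H) (x y : H) : ⟪T x, T y⟫_ℂ = ⟪y, x⟫_ℂ := by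
  have hI : I • T y = T (-(I • y)) := by
    rw [map_neg, map_smulₛₗ, Complex.conj_I, neg_smul, neg_neg]
  rw [← inner_conj_symm y x, inner_eq_sum_norm_sq_div_four (T x), inner_eq_sum_norm_sq_div_four x]
  simp only [RCLike.I_to_complex, hI, ← map_sub, ← map_add, LinearIsometryEquiv.norm_map]
  have h4 : (starRingEnd ℂ) 4 = 4 := map_ofNat _ 4
  simp [sub_neg_eq_add, ← sub_eq_add_neg, h4]
  ring

lemma inner_antiunitary_left (T : H ≃ₗᵢ⋆[ℂ] H) (x y : H) : ⟪T x, y⟫_ℂ = ⟪T.symm y, x⟫_ℂ := by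
  rw [← inner_antiunitary T x, T.apply_symm_apply]

variable [CompleteSpace H]

/-- Conjugation `X ↦ T X T⁻¹` by an antiunitary operator. -/
def conjT (T : H ≃ₗᵢ⋆[ℂ] H) : (H →L[ℂ] H) →⋆ₐ[ℝ] (H →L[ℂ] H) where
  toFun X := (T.toContinuousLinearEquiv : H →SL[starRingEnd ℂ] H).comp
    (X.comp (T.symm.toContinuousLinearEquiv : H →SL[starRingEnd ℂ] H))
  map_one' := by ext; simp
  map_mul' X Y := by ext; simp
  map_zero' := by ext; simp
  map_add' X Y := by ext; simp
  commutes' r := by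
    ext x
    simp only [Algebra.algebraMap_eq_smul_one]
    change T ((r : ℂ) • T.symm x) = (r : ℂ) • x
    rw [map_smulₛₗ, Complex.conj_ofReal, T.apply_symm_apply]
  map_star' X := by
    rw [ContinuousLinearMap.star_eq_adjoint, ContinuousLinearMap.star_eq_adjoint,
      ContinuousLinearMap.eq_adjoint_iff]
    intro x y
    simp only [ContinuousLinearMap.comp_apply, ContinuousLinearEquiv.coe_coe,
      LinearIsometryEquiv.coe_toContinuousLinearEquiv]
    rw [inner_antiunitary_left, ContinuousLinearMap.adjoint_inner_right,
      ← inner_antiunitary T (T.symm x), T.apply_symm_apply]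

lemma conjT_apply (T : H ≃ₗᵢ⋆[ℂ] H) (X : H →L[ℂ] H) (x : H) : conjT T X x = T (X (T.symm x)) := rfl

lemma conjT_apply_map (T : H ≃ₗᵢ⋆[ℂ] H) (X : H →L[ℂ] H) (x : H) :
    conjT T X (T x) = T (X x) := by simp [conjT_apply]

lemma conjT_eq_iff (T : H ≃ₗᵢ⋆[ℂ] H) (X Y : H →L[ℂ] H) :
    conjT T X = Y ↔ ∀ x, T (X x) = Y (T x) := by
  constructor
  · rintro rfl x
    exact (conjT_apply_map T X x).symm
  · intro h
    ext x
    rw [conjT_apply, h, T.apply_symm_apply]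

lemma isPhaseMap_conjT (T : H ≃ₗᵢ⋆[ℂ] H) : IsPhaseMap (conjT T) (-1) where
  norm_map X := by
    have key : ∀ (S : H ≃ₗᵢ⋆[ℂ] H) (Y : H →L[ℂ] H), ‖conjT S Y‖ ≤ ‖Y‖ := fun S Y =>
      ContinuousLinearMap.opNorm_le_bound _ (norm_nonneg _) fun x => by
        rw [conjT_apply, S.norm_map, ← S.symm.norm_map x]
        exact Y.le_opNorm _
    refine le_antisymm (key T X) ?_
    have : conjT T.symm (conjT T X) = X := by ext x; simp [conjT_apply]
    calc ‖X‖ = ‖conjT T.symm (conjT T X)‖ := by rw [this]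
      _ ≤ _ := key _ _
  map_I_smul X := by ext x; simp [conjT_apply, map_smulₛₗ]
  abs_eps := by simp

end Antiunitary

/-! ### Finite rank perturbations of the identity. -/

section FiniteRank

variable {H : Type*} [NormedAddCommGroup H] [InnerProductSpace ℂ H]

/-- Operators with finite-dimensional range. -/
def IsFiniteRank (K : H →L[ℂ] H) : Prop :=
  ∃ F : Submodule ℂ H, FiniteDimensional ℂ F ∧ ∀ x, K x ∈ F

lemma IsFiniteRank.mul_right {K : H →L[ℂ] H} (hK : IsFiniteRank K) (X : H →L[ℂ] H) :
    IsFiniteRank (K * X) := by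
  obtain ⟨F, hF, h⟩ := hK
  exact ⟨F, hF, fun x => h _⟩

lemma IsFiniteRank.mul_left {K : H →L[ℂ] H} (hK : IsFiniteRank K) (X : H →L[ℂ] H) :
    IsFiniteRank (X * K) := by
  obtain ⟨F, hF, h⟩ := hK
  exact ⟨F.map (X : H →ₗ[ℂ] H), inferInstance, fun x => ⟨K x, h x, rfl⟩⟩

lemma IsFiniteRank.add {K K' : H →L[ℂ] H} (hK : IsFiniteRank K) (hK' : IsFiniteRank K') :
    IsFiniteRank (K + K') := by
  obtain ⟨F, hF, h⟩ := hK
  obtain ⟨F', hF', h'⟩ := hK'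
  exact ⟨F ⊔ F', inferInstance, fun x => add_mem (Submodule.mem_sup_left (h x))
    (Submodule.mem_sup_right (h' x))⟩

lemma IsFiniteRank.neg {K : H →L[ℂ] H} (hK : IsFiniteRank K) : IsFiniteRank (-K) := by
  obtain ⟨F, hF, h⟩ := hK
  exact ⟨F, hF, fun x => neg_mem (h x)⟩

lemma IsFiniteRank.sub {K K' : H →L[ℂ] H} (hK : IsFiniteRank K) (hK' : IsFiniteRank K') :
    IsFiniteRank (K - K') := by
  rw [sub_eq_add_neg]
  exact hK.add hK'.neg

lemma isFiniteRank_zero : IsFiniteRank (0 : H →L[ℂ] H) := ⟨⊥, inferInstance, fun x => by simp⟩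

lemma IsFiniteRank.isCompactOperator {K : H →L[ℂ] H} (hK : IsFiniteRank K) :
    IsCompactOperator K := by
  obtain ⟨F, hF, h⟩ := hK
  have h1 : IsCompactOperator (K.codRestrict F h : H → F) :=
    have : ProperSpace F := FiniteDimensional.proper ℂ F
    isCompactOperator_of_locallyCompactSpace_dom (K.codRestrict F h)
  exact h1.clm_comp F.subtypeL

variable [CompleteSpace H]

/-- Nonzero spectral values of a compact operator are eigenvalues, and their eigenvectors lie in the
finite-dimensional space containing the range. -/
lemma IsFiniteRank.finite_spectrum {K : H →L[ℂ] H} (hK : IsFiniteRank K) :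
    (spectrum ℂ K).Finite := by
  obtain ⟨F, hF, h⟩ := id hK
  let K' : Module.End ℂ F := (K : H →ₗ[ℂ] H).restrict (p := F) (q := F) fun x _ => h x
  refine ((K'.finite_hasEigenvalue).insert 0).subset fun μ hμ => ?_
  by_cases h0 : μ = 0
  · exact Or.inl h0
  · right
    rw [← hK.isCompactOperator.hasEigenvalue_iff_mem_spectrum h0] at hμ
    obtain ⟨x, hx⟩ := hμ.exists_hasEigenvector
    have hx1 : K x = μ • x := hx.apply_eq_smul
    have hxF : x ∈ F := by
      have := F.smul_mem μ⁻¹ (h x)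
      rwa [hx1, inv_smul_smul₀ h0] at this
    refine Module.End.hasEigenvalue_of_hasEigenvector (x := ⟨x, hxF⟩) ?_
    rw [Module.End.hasEigenvector_iff]
    refine ⟨?_, fun h => hx.2 (congrArg Subtype.val h)⟩
    rw [Module.End.mem_eigenspace_iff]
    exact Subtype.ext hx1

lemma Proj.isFiniteRank {m : ℕ} {p : H →L[ℂ] H} (hp : p ∈ Proj H m) : IsFiniteRank p := by
  refine ⟨LinearMap.range (p : H →ₗ[ℂ] H), ?_, fun x => ⟨x, rfl⟩⟩
  have h := hp.2
  rw [LinearMap.rank] at h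
  exact Module.rank_lt_aleph0_iff.mp (by rw [h]; exact Cardinal.natCast_lt_aleph0)

lemma inv_mul_of_mul_eq {p q : H →L[ℂ] H} {X : unitary (H →L[ℂ] H)} (h : q * X = X * p) :
    p * (X⁻¹ : unitary (H →L[ℂ] H)) = (X⁻¹ : unitary (H →L[ℂ] H)) * q := by
  have e1 : ((X⁻¹ : unitary (H →L[ℂ] H)) : H →L[ℂ] H) * X = 1 := by
    rw [← Submonoid.coe_mul, inv_mul_cancel, OneMemClass.coe_one]
  have e2 : (X : H →L[ℂ] H) * (X⁻¹ : unitary (H →L[ℂ] H)) = 1 := by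
    rw [← Submonoid.coe_mul, mul_inv_cancel, OneMemClass.coe_one]
  calc _ = ((X⁻¹ : unitary (H →L[ℂ] H)) : H →L[ℂ] H) * X * p * (X⁻¹ : unitary (H →L[ℂ] H)) := by
        rw [e1, one_mul]
    _ = _ := by
        rw [mul_assoc _ (X : H →L[ℂ] H) p, ← h, mul_assoc, mul_assoc, e2, mul_one]

/-- A root of a unitary that is a finite rank perturbation of `1` has the same property. -/
lemma isFiniteRank_phaseRoot_sub_one {a : H →L[ℂ] H} (ha : a ∈ unitary (H →L[ℂ] H))
    (h : ‖a - 1‖ < 2) (hF : IsFiniteRank (a - 1)) :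
    IsFiniteRank ((phaseRoot a : H →L[ℂ] H) - 1) := by
  have h1 := (Unitary.norm_sub_one_lt_two_iff (phaseRoot a).2).mp (norm_phaseRoot_sub_one_lt ha h)
  rw [spectrum.notMem_iff] at h1
  obtain ⟨u, hu⟩ := h1
  -- With `K` the root, `a - 1 = (K - 1)(K + 1)`, and `u = -(K + 1)` is invertible.
  have e : ((phaseRoot a : H →L[ℂ] H) - 1) = (a - 1) * (-(↑u⁻¹ : H →L[ℂ] H)) := by
    rw [mul_neg, eq_neg_iff_add_eq_zero, ← eq_neg_iff_add_eq_zero, ← neg_mul,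
      Units.eq_mul_inv_iff_mul_eq, hu]
    nth_rw 3 [← phaseRoot_mul_self ha h]
    simp only [map_neg, map_one]
    noncomm_ring
  rw [e]
  exact hF.mul_right _

lemma isFiniteRank_unitary_mul {a b : unitary (H →L[ℂ] H)}
    (ha : IsFiniteRank ((a : H →L[ℂ] H) - 1)) (hb : IsFiniteRank ((b : H →L[ℂ] H) - 1)) :
    IsFiniteRank (((a * b : unitary (H →L[ℂ] H)) : H →L[ℂ] H) - 1) := by
  have : ((a * b : unitary (H →L[ℂ] H)) : H →L[ℂ] H) - 1 = a * (b - 1) + (a - 1) := by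
    rw [Submonoid.coe_mul, mul_sub, mul_one, sub_add_sub_cancel]
  rw [this]
  exact (hb.mul_left _).add ha

lemma isFiniteRank_unitary_inv {a : unitary (H →L[ℂ] H)}
    (ha : IsFiniteRank ((a : H →L[ℂ] H) - 1)) :
    IsFiniteRank (((a⁻¹ : unitary (H →L[ℂ] H)) : H →L[ℂ] H) - 1) := by
  have : ((a⁻¹ : unitary (H →L[ℂ] H)) : H →L[ℂ] H) - 1 =
      ((a⁻¹ : unitary (H →L[ℂ] H)) : H →L[ℂ] H) * -(a - 1) := by
    rw [mul_neg, mul_sub, ← Submonoid.coe_mul, inv_mul_cancel]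
    simp
  rw [this]
  exact ha.neg.mul_left _

/-- Expanding a product of two reflections minus `1` leaves only terms containing one of the finite
rank projections; roots and products keep the property. -/
lemma isFiniteRank_chain {f : ℕ → H →L[ℂ] H} (hp : ∀ i, IsStarProjection (f i))
    (hF : ∀ i, IsFiniteRank (f i)) {N : ℕ} (h : ∀ i < N, ‖f (i + 1) - f i‖ < 1) :
    IsFiniteRank ((chain f N : H →L[ℂ] H) - 1) := by
  induction N with
  | zero => simpa [chain] using isFiniteRank_zero
  | succ N ih =>
    refine isFiniteRank_unitary_mul ?_ (ih fun i hi => h i (by omega))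
    refine isFiniteRank_phaseRoot_sub_one (reflection_mul_mem (hp _) (hp _))
      (norm_reflection_mul_sub_one (hp _) (h N (by omega))) ?_
    have : reflection (f (N + 1)) * reflection (f N) - 1 =
        f (N + 1) * (2 * (2 * f N - 1)) - f N - f N := by
      simp only [reflection]
      noncomm_ring
    rw [this]
    exact (((hF _).mul_right _).sub (hF _)).sub (hF _)

end FiniteRank

/-! ### Logarithms compatible with `T`. -/

section Log

variable {H : Type*} [NormedAddCommGroup H] [InnerProductSpace ℂ H] [CompleteSpace H]

/-- The spectrum is finite and the circle infinite, so some rotation moves the spectrum off `-1`. -/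
lemma exists_rotation_norm_lt {A : H →L[ℂ] H} (hA : A ∈ unitary (H →L[ℂ] H))
    (hF : IsFiniteRank (A - 1)) : ∃ θ : ℝ, ‖cexp (I * θ) • A - 1‖ < 2 := by
  have hfin : (spectrum ℂ A).Finite := by
    have h1 : spectrum ℂ A = ({1} : Set ℂ) + spectrum ℂ (A - 1) := by
      rw [spectrum.singleton_add_eq, map_one, add_sub_cancel]
    rw [h1]
    exact (Set.finite_singleton _).add hF.finite_spectrum
  have hinf : (Set.Ioc (-π) π).Infinite := Set.Ioc_infinite (by linarith [Real.pi_pos])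
  -- `-e^{-iθ}` is the point that rotation by `θ` carries to `-1`; it must avoid the spectrum.
  have hinj : Set.InjOn (fun θ : ℝ => -(Circle.exp (-θ) : ℂ)) (Set.Ioc (-π) π) := by
    intro a ha b hb h
    simp only [neg_inj, Circle.coe_inj, Circle.exp_neg, inv_inj] at h
    rw [← Circle.arg_exp ha.1 ha.2, h, Circle.arg_exp hb.1 hb.2]
  obtain ⟨z, ⟨θ, -, rfl⟩, hz⟩ := (hinf.image hinj).exists_notMem_finite hfin
  refine ⟨θ, ?_⟩
  have hc : cexp (I * θ) • A = Circle.exp θ • A := by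
    rw [Circle.smul_def, Circle.coe_exp, mul_comm]
  have hmem : cexp (I * θ) • A ∈ unitary (H →L[ℂ] H) := by
    have h1 : (starRingEnd ℂ) (Circle.exp θ : ℂ) * Circle.exp θ = 1 := by
      rw [← Circle.coe_inv_eq_conj, ← Circle.coe_mul, inv_mul_cancel, Circle.coe_one]
    rw [hc, Circle.smul_def]
    rw [Unitary.mem_iff] at hA ⊢
    simp only [star_smul, smul_mul_smul_comm, hA.1, hA.2, RCLike.star_def, h1, one_smul,
      mul_comm _ ((starRingEnd ℂ) _), and_self]
  rw [Unitary.norm_sub_one_lt_two_iff hmem]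
  intro h
  apply hz
  have hne : cexp (I * θ) ≠ 0 := Complex.exp_ne_zero _
  have h2 : (Units.mk0 _ hne)⁻¹ • (-1 : ℂ) ∈ spectrum ℂ ((Units.mk0 _ hne)⁻¹ • cexp (I * θ) • A) := by
    rw [spectrum.smul_mem_smul_iff]
    exact h
  have h3 : (Units.mk0 _ hne)⁻¹ • cexp (I * θ) • A = A := by
    rw [Units.smul_def, smul_smul]; simp
  rw [h3] at h2
  convert h2 using 1
  simp [Units.smul_def, Circle.coe_exp, mul_comm]

/-- A unitary finite rank perturbation of `1` with `T A T⁻¹ = A⁻¹` has a logarithm that commutes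
with `T` and with every projection that commutes with `A`. -/
lemma exists_log (T : H ≃ₗᵢ⋆[ℂ] H) (A : unitary (H →L[ℂ] H))
    (hF : IsFiniteRank ((A : H →L[ℂ] H) - 1)) (hT : conjT T A = star (A : H →L[ℂ] H)) :
    ∃ L : selfAdjoint (H →L[ℂ] H), rotor L 1 = A ∧
      (∀ r, conjT T (rotor L r) = rotor L (-r)) ∧
      ∀ p : H →L[ℂ] H, IsStarProjection p → p * A = A * p → ∀ r, p * rotor L r = rotor L r * p := by
  obtain ⟨θ, hθ⟩ := exists_rotation_norm_lt A.2 hF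
  obtain ⟨L, hL, h1, h2⟩ := exists_log_of_gap A hθ
  refine ⟨L, by rw [rotor_one, hL], fun r => ?_, fun p hp hpA r => ?_⟩
  · rw [(isPhaseMap_conjT T).map_rotor (h1 _ (isPhaseMap_conjT T) hT), neg_one_mul]
  · rw [← unitaryConj_reflection_eq_iff hp] at hpA ⊢
    rw [(isPhaseMap_unitaryConj _).map_rotor (h2 _ (isPhaseMap_unitaryConj _) hpA), one_mul]

end Log

end

section

open Complex selfAdjoint
open scoped Real InnerProductSpace

/-! ### Symmetric frames on the circle and the cylinder. -/

section Transport

/-- Uniform continuity on a compact set gives one `N` for all endpoints `t`. The grid is scaled by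
`t`, so that `t ↦ -t` reflects it onto itself. -/
lemma exists_uniform_steps {X E : Type*} [PseudoMetricSpace X] [CompactSpace X]
    [NormedAddCommGroup E] {Q : ℝ → X → E} (hQ : Continuous fun q : ℝ × X => Q q.1 q.2) (a : ℝ) :
    ∃ N : ℕ, 0 < N ∧ ∀ t ∈ Set.Icc (-a) a, ∀ x, ∀ i < N,
      ‖Q (t * ((i + 1 : ℕ) / N)) x - Q (t * (i / N)) x‖ < 1 := by
  have hK : IsCompact (Set.Icc (-a) a ×ˢ (Set.univ : Set X)) := isCompact_Icc.prod isCompact_univ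
  have hu := hK.uniformContinuousOn_of_continuous hQ.continuousOn
  rw [Metric.uniformContinuousOn_iff] at hu
  obtain ⟨δ, hδ, h⟩ := hu 1 one_pos
  obtain ⟨N, hN⟩ := exists_nat_gt (|a| / δ)
  have hN0 : (0 : ℝ) < N := lt_of_le_of_lt (by positivity) hN
  refine ⟨N, by exact_mod_cast hN0, fun t ht x i hi => ?_⟩
  have hmem : ∀ j : ℕ, j ≤ N → t * (j / N) ∈ Set.Icc (-a) a := by
    intro j hj
    have h0 : (0 : ℝ) ≤ j / N := by positivity
    have h1 : (j : ℝ) / N ≤ 1 := by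
      rw [div_le_one hN0]
      exact_mod_cast hj
    have ha : |t| ≤ a := abs_le.mpr ht
    rw [Set.mem_Icc, ← abs_le, abs_mul, abs_of_nonneg h0]
    nlinarith [abs_nonneg t]
  rw [← dist_eq_norm]
  refine h (_, x) ⟨hmem _ (by omega), trivial⟩ (_, x) ⟨hmem _ (by omega), trivial⟩ ?_
  rw [Prod.dist_eq, dist_self, Real.dist_eq, ← mul_sub, max_lt_iff]
  refine ⟨?_, hδ⟩
  have e : ((i + 1 : ℕ) : ℝ) / N - i / N = 1 / N := by
    push_cast
    ring
  rw [e, abs_mul, abs_of_nonneg (a := (1 : ℝ) / N) (by positivity), mul_one_div, div_lt_iff₀ hN0]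
  have ha : |t| ≤ |a| := (abs_le.mpr ht).trans (le_abs_self a)
  rw [div_lt_iff₀ hδ] at hN
  linarith [mul_comm δ (N : ℝ)]

variable {H : Type*} [NormedAddCommGroup H] [InnerProductSpace ℂ H] [CompleteSpace H]
  {T : H ≃ₗᵢ⋆[ℂ] H} {m : ℕ} {P : Torus2 → H →L[ℂ] H}

instance : CompactSpace Real.Angle :=
  have : Fact (0 < 2 * π) := ⟨Real.two_pi_pos⟩
  inferInstanceAs (CompactSpace (AddCircle (2 * π)))

lemma IsTRSymmetric.isStarProjection (hP : IsTRSymmetric T m P) (k : Torus2) :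
    IsStarProjection (P k) := (hP.mem_proj k).1

lemma IsTRSymmetric.conjT_eq (hP : IsTRSymmetric T m P) (k : Torus2) :
    conjT T (P k) = P (-k) := (conjT_eq_iff _ _ _).mpr (hP.symm k)

lemma coe_neg_pi_eq : ((-π : ℝ) : Real.Angle) = (π : ℝ) := by simp

/-- A symmetric family of unitaries along the circle `t = 0`. -/
lemma IsTRSymmetric.exists_circle_frame (hP : IsTRSymmetric T m P) :
    ∃ W : Real.Angle → unitary (H →L[ℂ] H), Continuous W ∧
      (∀ k, P (0, k) * W k = W k * P (0, 0)) ∧ ∀ k, conjT T (W k) = W (-k) := by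
  have hπ := Real.pi_pos
  have hc : Continuous fun q : ℝ × Unit => P (0, (q.1 : Real.Angle)) :=
    hP.continuous.comp (continuous_const.prodMk (Real.Angle.continuous_coe.comp continuous_fst))
  obtain ⟨N, hN, hstep⟩ := exists_uniform_steps (Q := fun s (_ : Unit) => P (0, (s : Real.Angle)))
    hc π
  have hN' : (N : ℝ) ≠ 0 := by positivity
  let f : ℝ → ℕ → H →L[ℂ] H := fun t i => P (0, ((t * (i / N) : ℝ) : Real.Angle))
  have hfp : ∀ t i, IsStarProjection (f t i) := fun t i => hP.isStarProjection _
  have hfs : ∀ t ∈ Set.Icc (-π) π, ∀ i < N, ‖f t (i + 1) - f t i‖ < 1 := fun t ht i hi =>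
    hstep t ht () i hi
  let V : ℝ → unitary (H →L[ℂ] H) := fun t => chain (f t) N
  have hfc : ∀ i, Continuous fun t => f t i := fun i => hP.continuous.comp
    (continuous_const.prodMk (Real.Angle.continuous_coe.comp (by fun_prop)))
  have hVc : ContinuousOn V (Set.Icc (-π) π) :=
    continuousOn_chain (f := fun i t => f t i) (fun i => (hfc i).continuousOn)
      (fun i t _ => hfp t i) fun i hi t ht => hfs t ht i hi
  have hVi : ∀ t ∈ Set.Icc (-π) π, P (0, (t : Real.Angle)) * V t = V t * P (0, 0) := by
    intro t ht
    have := mul_chain (hfp t) (hfs t ht)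
    have h1 : f t N = P (0, (t : Real.Angle)) := by simp [f, div_self hN']
    have h0 : f t 0 = P (0, 0) := by simp [f]
    rwa [h1, h0] at this
  have hVs : ∀ t ∈ Set.Icc (-π) π, conjT T (V t) = V (-t) := fun t ht =>
    (isPhaseMap_conjT T).map_chain (fun i => by
      simp only [f]
      rw [hP.conjT_eq]
      simp) (hfp t) (hfs t ht)
  have hVF : ∀ t ∈ Set.Icc (-π) π, IsFiniteRank ((V t : H →L[ℂ] H) - 1) := fun t ht =>
    isFiniteRank_chain (hfp t) (fun i => Proj.isFiniteRank (hP.mem_proj _)) (hfs t ht)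
  have hmp : π ∈ Set.Icc (-π) π := ⟨by linarith, le_rfl⟩
  have hmn : -π ∈ Set.Icc (-π) π := ⟨le_rfl, by linarith⟩
  set p := P (0, 0) with hp
  set A : unitary (H →L[ℂ] H) := (V π)⁻¹ * V (-π) with hA
  have hAp : p * A = A * p := by
    have h1 := hVi π hmp
    have h2 := hVi _ hmn
    rw [coe_neg_pi_eq] at h2
    rw [hA, Submonoid.coe_mul, ← mul_assoc, inv_mul_of_mul_eq h1, mul_assoc, h2, mul_assoc]
  have hAT : conjT T A = star (A : H →L[ℂ] H) := by
    rw [hA, ← Unitary.coe_star, star_mul, Submonoid.coe_mul, map_mul, hVs _ hmn, neg_neg,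
      ← Unitary.star_eq_inv, Unitary.coe_star, map_star, hVs _ hmp, star_star, Submonoid.coe_mul,
      Unitary.coe_star]
  obtain ⟨L, hL1, hLT, hLp⟩ := exists_log T A
    (isFiniteRank_unitary_mul (isFiniteRank_unitary_inv (hVF _ hmp)) (hVF _ hmn)) hAT
  -- At `∓π` the correction is `A^{∓1/2}`, and `V(-π) A^{-1/2} = V(π) A^{1/2}`. The exponent is odd
  -- in `t`, which keeps the symmetry under `T`.
  let W : ℝ → unitary (H →L[ℂ] H) := fun t => V t * rotor L (t / (2 * π))
  have hWper : W (-π) = W π := by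
    have e1 : -π / (2 * π) = -(1 / 2) := by field_simp
    have e2 : π / (2 * π) = 1 / 2 := by field_simp
    have e3 : rotor L (1 / 2) = A * rotor L (-(1 / 2)) := by
      rw [← hL1, ← rotor_add]; norm_num
    simp only [W]
    rw [e1, e2, e3, hA, mul_assoc, mul_inv_cancel_left]
  have hWc : ContinuousOn W (Set.Icc (-π) π) :=
    hVc.mul ((continuous_rotor L).comp (continuous_id.div_const _)).continuousOn
  have : Fact (0 < 2 * π) := ⟨by positivity⟩
  have e2 : -π + 2 * π = π := by ring
  let W' : Real.Angle → unitary (H →L[ℂ] H) := AddCircle.liftIco (2 * π) (-π) W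
  have hW' : ∀ t ∈ Set.Icc (-π) π, W' (t : Real.Angle) = W t := by
    intro t ht
    rcases eq_or_lt_of_le ht.2 with h | h
    · rw [h, ← coe_neg_pi_eq, ← hWper]
      exact AddCircle.liftIco_coe_apply ⟨le_rfl, by linarith⟩
    · exact AddCircle.liftIco_coe_apply ⟨ht.1, by linarith⟩
  have hrep : ∀ k : Real.Angle, ∃ t ∈ Set.Icc (-π) π, k = t := fun k =>
    ⟨k.toReal, ⟨(Real.Angle.neg_pi_lt_toReal k).le, Real.Angle.toReal_le_pi k⟩, by simp⟩
  refine ⟨W', ?_, ?_, ?_⟩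
  · exact AddCircle.liftIco_continuous (by rw [e2]; exact hWper) (by rwa [e2])
  · intro k
    obtain ⟨t, ht, rfl⟩ := hrep k
    rw [hW' t ht, Submonoid.coe_mul, ← mul_assoc, hVi t ht, mul_assoc,
      hLp p (hP.isStarProjection _) hAp, mul_assoc]
  · intro k
    obtain ⟨t, ht, rfl⟩ := hrep k
    rw [← Real.Angle.coe_neg, hW' t ht, hW' (-t) ⟨by linarith [ht.2], by linarith [ht.1]⟩]
    rw [Submonoid.coe_mul, map_mul, hVs t ht, hLT, Submonoid.coe_mul, neg_div]

/-- A symmetric family of unitaries on the cylinder `[-π,π] × 𝕋`. -/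
lemma IsTRSymmetric.exists_frame (hP : IsTRSymmetric T m P) :
    ∃ U : ℝ → Real.Angle → unitary (H →L[ℂ] H),
      ContinuousOn (fun q : ℝ × Real.Angle => U q.1 q.2) (Set.Icc (-π) π ×ˢ Set.univ) ∧
      (∀ t ∈ Set.Icc (-π) π, ∀ k : Real.Angle,
        P ((t : Real.Angle), k) * U t k = U t k * P (0, 0)) ∧
      (∀ t ∈ Set.Icc (-π) π, ∀ k : Real.Angle, conjT T (U t k) = U (-t) (-k)) ∧
      ∀ k, IsFiniteRank ((((U π k)⁻¹ * U (-π) k : unitary (H →L[ℂ] H)) : H →L[ℂ] H) - 1) := by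
  have hπ := Real.pi_pos
  obtain ⟨W, hWc, hWi, hWs⟩ := hP.exists_circle_frame
  have hc : Continuous fun q : ℝ × Real.Angle => P ((q.1 : Real.Angle), q.2) :=
    hP.continuous.comp ((Real.Angle.continuous_coe.comp continuous_fst).prodMk continuous_snd)
  obtain ⟨N, hN, hstep⟩ := exists_uniform_steps
    (Q := fun s (k : Real.Angle) => P ((s : Real.Angle), k)) hc π
  have hN' : (N : ℝ) ≠ 0 := by positivity
  let f : ℝ × Real.Angle → ℕ → H →L[ℂ] H := fun q i => P (((q.1 * (i / N) : ℝ) : Real.Angle), q.2)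
  have hfp : ∀ q i, IsStarProjection (f q i) := fun q i => hP.isStarProjection _
  have hfs : ∀ q ∈ Set.Icc (-π) π ×ˢ (Set.univ : Set Real.Angle), ∀ i < N,
      ‖f q (i + 1) - f q i‖ < 1 := fun q hq i hi => hstep q.1 hq.1 q.2 i hi
  have hfc : ∀ i, Continuous fun q => f q i := fun i => hP.continuous.comp
    ((Real.Angle.continuous_coe.comp (by fun_prop)).prodMk continuous_snd)
  let R : ℝ × Real.Angle → unitary (H →L[ℂ] H) := fun q => chain (f q) N
  have hRc : ContinuousOn R (Set.Icc (-π) π ×ˢ Set.univ) :=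
    continuousOn_chain (f := fun i q => f q i) (fun i => (hfc i).continuousOn)
      (fun i q _ => hfp q i) fun i hi q hq => hfs q hq i hi
  have hRF : ∀ q ∈ Set.Icc (-π) π ×ˢ (Set.univ : Set Real.Angle),
      IsFiniteRank ((R q : H →L[ℂ] H) - 1) := fun q hq =>
    isFiniteRank_chain (hfp q) (fun i => Proj.isFiniteRank (hP.mem_proj _)) (hfs q hq)
  -- `W` moves from `(0,0)` to `(0,k)`, then `R` from `(0,k)` to `(t,k)`.
  refine ⟨fun t k => R (t, k) * W k, ?_, ?_, ?_, ?_⟩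
  · exact hRc.mul (hWc.comp continuous_snd).continuousOn
  · intro t ht k
    have := mul_chain (hfp (t, k)) (hfs (t, k) ⟨ht, trivial⟩)
    have h1 : f (t, k) N = P ((t : Real.Angle), k) := by simp [f, div_self hN']
    have h0 : f (t, k) 0 = P (0, k) := by simp [f]
    rw [h1, h0] at this
    rw [Submonoid.coe_mul, ← mul_assoc, this, mul_assoc, hWi, mul_assoc]
  · intro t ht k
    rw [Submonoid.coe_mul, map_mul, hWs, Submonoid.coe_mul]
    congr 1
    exact (isPhaseMap_conjT T).map_chain (fun i => by
      simp only [f]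
      rw [hP.conjT_eq]
      simp) (hfp _) (hfs _ ⟨ht, trivial⟩)
  · intro k
    have hF := isFiniteRank_unitary_mul
      (isFiniteRank_unitary_inv (hRF (π, k) ⟨⟨by simp; linarith, le_rfl⟩, trivial⟩))
      (hRF (-π, k) ⟨⟨le_rfl, by simp; linarith⟩, trivial⟩)
    -- The mismatch of the frame is that of `R` conjugated by `W k`, so finite rank is needed for
    -- `R` only.
    have e : (((R (π, k) * W k)⁻¹ * (R (-π, k) * W k) : unitary (H →L[ℂ] H)) : H →L[ℂ] H) - 1 =
        ((W k)⁻¹ : unitary (H →L[ℂ] H)) *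
          ((((R (π, k))⁻¹ * R (-π, k) : unitary (H →L[ℂ] H)) : H →L[ℂ] H) - 1) * W k := by
      rw [mul_sub, sub_mul, mul_one, ← Submonoid.coe_mul, ← Submonoid.coe_mul, ← Submonoid.coe_mul,
        inv_mul_cancel, OneMemClass.coe_one]
      simp only [mul_inv_rev, mul_assoc]
    rw [e]
    exact (hF.mul_left _).mul_right _

/-- Symmetrically homotopic families are symmetrically unitarily equivalent. -/
lemma SymmHomotopic.symmUnitarilyEquivalent {P₀ P₁ : Torus2 → H →L[ℂ] H}
    (h : SymmHomotopic T m P₀ P₁) : SymmUnitarilyEquivalent T P₀ P₁ := by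
  obtain ⟨P, hPc, hPp, hP0, hP1, hPs⟩ := h
  -- Clamping extends the homotopy to all real parameters; the transport then runs along `[0,1]`
  -- with `k` fixed.
  let Q : ℝ → Torus2 → H →L[ℂ] H := fun t k => P (Set.projIcc 0 1 zero_le_one t, k)
  have hQc : Continuous fun q : ℝ × Torus2 => Q q.1 q.2 :=
    hPc.comp ((continuous_projIcc.comp continuous_fst).prodMk continuous_snd)
  obtain ⟨N, hN, hstep⟩ := exists_uniform_steps hQc 1
  have hN' : (N : ℝ) ≠ 0 := by positivity
  let f : Torus2 → ℕ → H →L[ℂ] H := fun k i => Q (1 * (i / N)) k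
  have hfp : ∀ k i, IsStarProjection (f k i) := fun k i => (hPp _).1
  have hfs : ∀ k, ∀ i < N, ‖f k (i + 1) - f k i‖ < 1 := fun k i hi =>
    hstep 1 (by norm_num) k i hi
  have hfc : ∀ i, Continuous fun k => f k i := fun i => hPc.comp (by fun_prop)
  refine ⟨fun k => chain (f k) N, ?_, ?_, ?_⟩
  · rw [← continuousOn_univ]
    exact continuousOn_chain (f := fun i k => f k i) (fun i => (hfc i).continuousOn)
      (fun i q _ => hfp q i) fun i hi q _ => hfs q i hi
  · intro k
    rw [← conjT_eq_iff]
    exact (isPhaseMap_conjT T).map_chain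
      (fun i => (conjT_eq_iff _ _ _).mpr (hPs _ k)) (hfp _) (hfs _)
  · intro k
    have := mul_chain (hfp k) (hfs k)
    have h1 : f k N = P₁ k := by
      rw [← hP1]
      simp [f, Q, div_self hN']
    have h0 : f k 0 = P₀ k := by
      rw [← hP0]
      simp [f, Q]
    rw [h1, h0] at this
    rw [← this, mul_assoc, ← Submonoid.coe_mul, mul_inv_cancel, OneMemClass.coe_one, mul_one]

end Transport

end

section

open Complex selfAdjoint Matrix
open scoped Real InnerProductSpace

/-! ### Transition matrices between orthonormal families. -/

section Transition

variable {H : Type*} [NormedAddCommGroup H] [InnerProductSpace ℂ H] {ι : Type*}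

/-- The matrix of the family `f` in the orthonormal family `e`; its rows are the coordinates of
the members of `f`. -/
def transition (e f : ι → H) : Matrix ι ι ℂ := Matrix.of fun j a => ⟪e a, f j⟫_ℂ

lemma conjTranspose_transition (e f : ι → H) : (transition e f)ᴴ = transition f e := by
  ext j a
  simp [transition]

lemma transition_self [DecidableEq ι] {e : ι → H} (he : Orthonormal ℂ e) : transition e e = 1 := by
  ext j a
  rw [transition, Matrix.of_apply, orthonormal_iff_ite.mp he, Matrix.one_apply]
  simp [eq_comm]

section Complete

variable [CompleteSpace H]

lemma orthonormal_unitary {e : ι → H} (he : Orthonormal ℂ e) (X : unitary (H →L[ℂ] H)) :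
    Orthonormal ℂ fun j => (X : H →L[ℂ] H) (e j) := by
  classical
  rw [orthonormal_iff_ite] at he ⊢
  simpa only [Unitary.inner_map_map] using he

lemma transition_unitary (e f : ι → H) (X : unitary (H →L[ℂ] H)) :
    transition (fun j => (X : H →L[ℂ] H) (e j)) (fun j => (X : H →L[ℂ] H) (f j)) =
      transition e f := by
  ext j a
  simp [transition, Unitary.inner_map_map]

lemma unitary_apply_inv_apply (X : unitary (H →L[ℂ] H)) (y : H) :
    (X : H →L[ℂ] H) (((X⁻¹ : unitary (H →L[ℂ] H)) : H →L[ℂ] H) y) = y := by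
  rw [← mul_apply_eq_comp, ← Submonoid.coe_mul, mul_inv_cancel, OneMemClass.coe_one,
    one_apply_eq_self]

lemma unitary_inv_apply_apply (X : unitary (H →L[ℂ] H)) (y : H) :
    ((X⁻¹ : unitary (H →L[ℂ] H)) : H →L[ℂ] H) ((X : H →L[ℂ] H) y) = y := by
  rw [← mul_apply_eq_comp, ← Submonoid.coe_mul, inv_mul_cancel, OneMemClass.coe_one,
    one_apply_eq_self]

lemma mem_range_iff_of_isStarProjection {p : H →L[ℂ] H} (hp : IsStarProjection p) {x : H} :
    x ∈ LinearMap.range (p : H →ₗ[ℂ] H) ↔ p x = x := by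
  constructor
  · rintro ⟨y, rfl⟩
    exact congrArg (fun q : H →L[ℂ] H => q y) hp.isIdempotentElem.eq
  · intro h
    exact ⟨x, h⟩

lemma apply_of_intertwines {p q : H →L[ℂ] H} (hp : IsStarProjection p) {X : unitary (H →L[ℂ] H)}
    (h : q * X = X * p) {u : ι → H}
    (hs : Submodule.span ℂ (Set.range u) = LinearMap.range (p : H →ₗ[ℂ] H)) (j : ι) :
    q ((X : H →L[ℂ] H) (u j)) = (X : H →L[ℂ] H) (u j) := by
  have h1 : p (u j) = u j := by
    rw [← mem_range_iff_of_isStarProjection hp, ← hs]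
    exact Submodule.subset_span ⟨j, rfl⟩
  have := congrArg (fun Z : H →L[ℂ] H => Z (u j)) h
  simpa only [mul_apply_eq_comp, h1] using this

end Complete

variable [Fintype ι]

lemma eq_sum_inner_of_mem_span {e : ι → H} (he : Orthonormal ℂ e) {y : H}
    (hy : y ∈ Submodule.span ℂ (Set.range e)) : y = ∑ a, ⟪e a, y⟫_ℂ • e a := by
  obtain ⟨c, rfl⟩ := (Submodule.mem_span_range_iff_exists_fun ℂ).mp hy
  exact Finset.sum_congr rfl fun a _ => by rw [he.inner_right_fintype]

/-- The family `f` lies in the span of the family `e`. -/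
def Expands (e f : ι → H) : Prop := ∀ j, f j = ∑ a, transition e f j a • e a

lemma eq_transition [DecidableEq ι] {e f : ι → H} (he : Orthonormal ℂ e) {α : Matrix ι ι ℂ}
    (h : ∀ j, f j = ∑ a, α j a • e a) : α = transition e f := by
  ext j a
  rw [transition, Matrix.of_apply, h, he.inner_right_fintype]

/-- Coordinates are stored in rows, so transitions compose in reversed order. -/
lemma transition_mul {e f g : ι → H} (hg : Expands f g) :
    transition f g * transition e f = transition e g := by
  ext j a
  rw [Matrix.mul_apply]
  conv_rhs => rw [transition, Matrix.of_apply, hg j, inner_sum]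
  simp only [inner_smul_right]
  rfl

lemma transition_mem_unitaryGroup [DecidableEq ι] {e f : ι → H} (hf : Orthonormal ℂ f)
    (h : Expands e f) : transition e f ∈ Matrix.unitaryGroup ι ℂ := by
  rw [Matrix.mem_unitaryGroup_iff, star_eq_conjTranspose, conjTranspose_transition,
    transition_mul h, transition_self hf]

variable [CompleteSpace H] in
/-- A unitary that carries `p` to `q` carries an orthonormal basis of the range of `p` to one of
the range of `q`. -/
lemma expands_of_intertwines {p q : H →L[ℂ] H} (hp : IsStarProjection p) {X : unitary (H →L[ℂ] H)}
    (h : q * X = X * p) {u : ι → H} (hu : Orthonormal ℂ u)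
    (hs : Submodule.span ℂ (Set.range u) = LinearMap.range (p : H →ₗ[ℂ] H)) {f : ι → H}
    (hf : ∀ j, q (f j) = f j) : Expands (fun j => (X : H →L[ℂ] H) (u j)) f := by
  intro j
  have h1 : ((X⁻¹ : unitary (H →L[ℂ] H)) : H →L[ℂ] H) (f j) ∈ Submodule.span ℂ (Set.range u) := by
    rw [hs, mem_range_iff_of_isStarProjection hp]
    have := congrArg (fun Z : H →L[ℂ] H => Z (f j)) (inv_mul_of_mul_eq h)
    simpa only [mul_apply_eq_comp, hf] using this
  have h2 := congrArg (X : H →L[ℂ] H) (eq_sum_inner_of_mem_span hu h1)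
  rw [unitary_apply_inv_apply, map_sum] at h2
  conv_lhs => rw [h2]
  refine Finset.sum_congr rfl fun a _ => ?_
  rw [map_smul, transition, Matrix.of_apply, ← Unitary.inner_map_map X, unitary_apply_inv_apply]

end Transition

/-! ### Determinants of symplectic and self-dual matrices. -/

section Symplectic

variable {n : ℕ}

lemma symplecticJ_mul_self : symplecticJ n * symplecticJ n = -1 := by
  simp [symplecticJ, Matrix.fromBlocks_multiply, ← Matrix.fromBlocks_one, Matrix.fromBlocks_neg]

lemma symplecticJ_inv : (symplecticJ n)⁻¹ = -symplecticJ n :=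
  Matrix.inv_eq_right_inv (by rw [mul_neg, symplecticJ_mul_self, neg_neg])

lemma symplecticJ_map_conj : (symplecticJ n).map (starRingEnd ℂ) = symplecticJ n := by
  ext i j
  rcases i with i | i <;> rcases j with j | j <;> simp [symplecticJ, Matrix.one_apply, apply_ite]

/-- The relation alone would only give `det² = 1` on taking determinants; excluding `-1` is what
makes the invariant well defined. -/
lemma det_eq_one_of_symplectic {S : Matrix (Fin n ⊕ Fin n) (Fin n ⊕ Fin n) ℂ}
    (h : Sᵀ * symplecticJ n * S = symplecticJ n) : S.det = 1 := by
  have hJ : Matrix.J (Fin n) ℂ = -symplecticJ n := by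
    simp [Matrix.J, symplecticJ, Matrix.fromBlocks_neg]
  refine SymplecticGroup.det_eq_one (SymplecticGroup.mem_iff'.mpr ?_)
  rw [hJ, mul_neg, neg_mul, h]

lemma transpose_mul_map_conj {ι : Type*} [Fintype ι] [DecidableEq ι] {M : Matrix ι ι ℂ}
    (hM : M ∈ Matrix.unitaryGroup ι ℂ) : Mᵀ * M.map (starRingEnd ℂ) = 1 := by
  have h := congrArg Matrix.transpose (Matrix.mem_unitaryGroup_iff'.mp hM)
  rwa [Matrix.transpose_mul, Matrix.transpose_one, star_eq_conjTranspose,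
    Matrix.conjTranspose, Matrix.transpose_map, Matrix.transpose_transpose] at h

lemma det_eq_one_of_quaternionic {M : Matrix (Fin n ⊕ Fin n) (Fin n ⊕ Fin n) ℂ}
    (hM : M ∈ Matrix.unitaryGroup (Fin n ⊕ Fin n) ℂ)
    (h : symplecticJ n * M = M.map (starRingEnd ℂ) * symplecticJ n) : M.det = 1 := by
  refine det_eq_one_of_symplectic ?_
  rw [mul_assoc, h, ← mul_assoc, transpose_mul_map_conj hM, one_mul]

/-- Explains the normalisation `μ(0) = 2λ₀` and why the invariant squares to `1`. -/
lemma det_selfdual_factor (γ : Matrix (Fin n ⊕ Fin n) (Fin n ⊕ Fin n) ℂ) :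
    (symplecticJ n * γᵀ * (symplecticJ n)⁻¹ * γ).det = γ.det ^ 2 := by
  have h : (symplecticJ n).det * ((symplecticJ n)⁻¹).det = 1 := by
    rw [← Matrix.det_mul, symplecticJ_inv, mul_neg, symplecticJ_mul_self, neg_neg, Matrix.det_one]
  rw [Matrix.det_mul, Matrix.det_mul, Matrix.det_mul, Matrix.det_transpose]
  linear_combination γ.det ^ 2 * h

/-- Two self-dual factorizations that are related by a change of frames have determinants related
by the determinant of the change of frames. -/
lemma det_mul_eq_of_selfdual_factor {γ γ' G G' : Matrix (Fin n ⊕ Fin n) (Fin n ⊕ Fin n) ℂ}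
    (hγ : γ ∈ Matrix.unitaryGroup (Fin n ⊕ Fin n) ℂ)
    (hG : G ∈ Matrix.unitaryGroup (Fin n ⊕ Fin n) ℂ)
    (hG' : symplecticJ n * G' = G.map (starRingEnd ℂ) * symplecticJ n)
    (h : symplecticJ n * γ'ᵀ * (symplecticJ n)⁻¹ * γ' * G =
      G' * (symplecticJ n * γᵀ * (symplecticJ n)⁻¹ * γ)) : γ'.det * G.det = γ.det := by
  set J := symplecticJ n
  have hJJ : J * J = -1 := symplecticJ_mul_self
  rw [symplecticJ_inv] at h
  -- Multiplying by `Gᵀ J` turns the relation into equality of two skew forms.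
  have h1 : Gᵀ * γ'ᵀ * J * γ' * G = γᵀ * J * γ := by
    have e := congrArg (fun Z => Gᵀ * (J * Z)) h
    beta_reduce at e
    have e1 : Gᵀ * (J * (J * γ'ᵀ * -J * γ' * G)) = Gᵀ * γ'ᵀ * J * γ' * G := by
      calc _ = Gᵀ * -(J * J) * γ'ᵀ * J * γ' * G := by noncomm_ring
        _ = _ := by rw [hJJ, neg_neg, mul_one]
    have e2 : Gᵀ * (J * (G' * (J * γᵀ * -J * γ))) = γᵀ * J * γ := by
      calc _ = Gᵀ * (J * G') * (J * γᵀ * -J * γ) := by noncomm_ring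
        _ = (Gᵀ * G.map (starRingEnd ℂ)) * -(J * J) * (γᵀ * J * γ) := by
          rw [hG']; noncomm_ring
        _ = _ := by rw [transpose_mul_map_conj hG, hJJ, neg_neg, mul_one, one_mul]
    rw [e1, e2] at e
    exact e
  have hγ1 : γ * star γ = 1 := Matrix.mem_unitaryGroup_iff.mp hγ
  -- Equality of the forms says that `γ' G γ*` preserves `J`.
  have hS : (γ' * G * star γ).det = 1 := by
    refine det_eq_one_of_symplectic ?_
    calc _ = (star γ)ᵀ * (Gᵀ * γ'ᵀ * J * γ' * G) * star γ := by
          rw [Matrix.transpose_mul, Matrix.transpose_mul]; noncomm_ring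
      _ = (γ * star γ)ᵀ * J * (γ * star γ) := by
          rw [h1, Matrix.transpose_mul]; noncomm_ring
      _ = J := by rw [hγ1]; simp
  have hd : γ.det * (star γ).det = 1 := by rw [← Matrix.det_mul, hγ1, Matrix.det_one]
  rw [Matrix.det_mul, Matrix.det_mul] at hS
  linear_combination γ.det * hS - γ'.det * G.det * hd

end Symplectic

/-! ### Time reversal on frames. -/

section Partner

variable {H : Type*} [NormedAddCommGroup H] [InnerProductSpace ℂ H] {n : ℕ}

/-- `T` carries the frame `e` to the frame `e'`, up to the matrix `J`. -/
def Partner (T : H ≃ₗᵢ⋆[ℂ] H) (e e' : Fin n ⊕ Fin n → H) : Prop :=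
  (∀ j, T (e (Sum.inl j)) = e' (Sum.inr j)) ∧ ∀ j, T (e (Sum.inr j)) = -e' (Sum.inl j)

/-- Antiunitarity conjugates inner products, while `J` records the swap of the two halves and its
sign. -/
lemma Partner.transition {T : H ≃ₗᵢ⋆[ℂ] H} {e e' f f' : Fin n ⊕ Fin n → H}
    (he : Partner T e e') (hf : Partner T f f') :
    symplecticJ n * transition e' f' = (transition e f).map (starRingEnd ℂ) * symplecticJ n := by
  have k1 : ∀ j, e' (Sum.inl j) = -T (e (Sum.inr j)) := fun j => by rw [he.2, neg_neg]
  have k2 : ∀ j, f' (Sum.inl j) = -T (f (Sum.inr j)) := fun j => by rw [hf.2, neg_neg]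
  ext j a
  rcases j with j | j <;> rcases a with a | a <;>
    simp [symplecticJ, Matrix.mul_apply, Fintype.sum_sum_type, Matrix.one_apply,
      TimeReversal.transition, ← he.1, ← hf.1, k1, k2, inner_antiunitary]

end Partner

/-! ### Quaternionic orthonormal bases. -/

section Basis

variable {H : Type*} [NormedAddCommGroup H] [InnerProductSpace ℂ H] {n : ℕ}

/-- Skewness, from `T² = -1`; in particular `x ⟂ T x`. -/
lemma inner_self_antiunitary {T : H ≃ₗᵢ⋆[ℂ] H} (hT : ∀ x, T (T x) = -x) (x y : H) :
    ⟪x, T y⟫_ℂ = -⟪y, T x⟫_ℂ := by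
  rw [← inner_antiunitary T, hT, inner_neg_left]

lemma orthonormal_elim_antiunitary {T : H ≃ₗᵢ⋆[ℂ] H} {k : ℕ} {v : Fin k → H}
    (h1 : ∀ i j, ⟪v i, v j⟫_ℂ = if i = j then 1 else 0) (h2 : ∀ i j, ⟪v i, T (v j)⟫_ℂ = 0) :
    Orthonormal ℂ (Sum.elim v fun j => T (v j)) := by
  rw [orthonormal_iff_ite]
  rintro (i | i) (j | j)
  · simp [h1]
  · simp [h2]
  · simpa using (inner_eq_zero_symm.mp (h2 j i))
  · simp [inner_antiunitary, h1, eq_comm]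

/-- In a `T`-invariant space of dimension at least `2k` there are `k` orthonormal quaternionic
pairs. -/
lemma exists_quaternionic_pairs {T : H ≃ₗᵢ⋆[ℂ] H} (hT : ∀ x, T (T x) = -x) (F : Submodule ℂ H)
    [FiniteDimensional ℂ F] (hF : ∀ x ∈ F, T x ∈ F) (k : ℕ) (hk : 2 * k ≤ Module.finrank ℂ F) :
    ∃ v : Fin k → H, (∀ j, v j ∈ F) ∧ (∀ i j, ⟪v i, v j⟫_ℂ = if i = j then 1 else 0) ∧
      ∀ i j, ⟪v i, T (v j)⟫_ℂ = 0 := by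
  have hself : ∀ x, ⟪x, T x⟫_ℂ = 0 := fun x => by
    have := inner_self_antiunitary hT x x
    linear_combination this / 2
  induction k with
  | zero => exact ⟨Fin.elim0, fun j => j.elim0, fun j => j.elim0, fun j => j.elim0⟩
  | succ k ih =>
    obtain ⟨v, hvF, h1, h2⟩ := ih (by omega)
    set K := Submodule.span ℂ (Set.range (Sum.elim v fun j => T (v j))) with hK
    have hKF : K ≤ F := by
      rw [hK, Submodule.span_le]
      rintro _ ⟨j | j, rfl⟩
      · exact hvF j
      · exact hF _ (hvF j)
    have hKd : Module.finrank ℂ K ≤ 2 * k := by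
      refine (finrank_range_le_card _).trans ?_
      simp [two_mul]
    have hsum := Submodule.finrank_add_inf_finrank_orthogonal hKF
    -- `K` has dimension at most `2k`, less than `2k + 2 ≤ dim F`, so `F` contains a unit vector
    -- orthogonal to all earlier pairs.
    have hpos : 0 < Module.finrank ℂ (Kᗮ ⊓ F : Submodule ℂ H) := by omega
    obtain ⟨x, hx, hx0⟩ := Submodule.exists_mem_ne_zero_of_ne_bot
      (fun h : Kᗮ ⊓ F = ⊥ => by rw [h] at hpos; simp at hpos)
    set y : H := (‖x‖⁻¹ : ℂ) • x
    have hy : y ∈ Kᗮ ⊓ F := Submodule.smul_mem _ _ hx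
    have hy1 : ‖y‖ = 1 := norm_smul_inv_norm hx0
    have ho : ∀ z ∈ K, ⟪z, y⟫_ℂ = 0 := (Submodule.mem_orthogonal _ _).mp hy.1
    have ho1 : ∀ j, ⟪v j, y⟫_ℂ = 0 := fun j => ho _ (Submodule.subset_span ⟨Sum.inl j, rfl⟩)
    have ho2 : ∀ j, ⟪T (v j), y⟫_ℂ = 0 := fun j => ho _ (Submodule.subset_span ⟨Sum.inr j, rfl⟩)
    refine ⟨Fin.cons y v, ?_, ?_, ?_⟩
    · intro j
      refine Fin.cases hy.2 (fun j => ?_) j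
      exact hvF j
    · intro i j
      refine Fin.cases ?_ (fun i => ?_) i <;> refine Fin.cases ?_ (fun j => ?_) j
      · simp [hy1]
      · simpa [(Fin.succ_ne_zero j).symm] using inner_eq_zero_symm.mp (ho1 j)
      · simpa using ho1 i
      · simpa using h1 i j
    · intro i j
      refine Fin.cases ?_ (fun i => ?_) i <;> refine Fin.cases ?_ (fun j => ?_) j
      · simpa using hself y
      · simpa using inner_eq_zero_symm.mp (ho2 j)
      · simp only [Fin.cons_succ, Fin.cons_zero]
        rw [inner_self_antiunitary hT, inner_eq_zero_symm.mp (ho2 i), neg_zero]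
      · simpa using h2 i j

/-- The range of a rank `2n` projection that commutes with `T` has a quaternionic orthonormal
basis. -/
lemma exists_quaternionic_basis [CompleteSpace H] {T : H ≃ₗᵢ⋆[ℂ] H} (hT : ∀ x, T (T x) = -x)
    {p : H →L[ℂ] H} (hp : p ∈ Proj H (2 * n)) (hpT : ∀ x, T (p x) = p (T x)) :
    ∃ u : Fin n ⊕ Fin n → H, Orthonormal ℂ u ∧
      Submodule.span ℂ (Set.range u) = LinearMap.range (p : H →ₗ[ℂ] H) ∧
      ∀ j, u (Sum.inr j) = T (u (Sum.inl j)) := by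
  set F := LinearMap.range (p : H →ₗ[ℂ] H) with hF
  have hr : Module.rank ℂ F = ((2 * n : ℕ) : Cardinal) := hp.2
  have hfd : FiniteDimensional ℂ F :=
    Module.rank_lt_aleph0_iff.mp (by rw [hr]; exact Cardinal.natCast_lt_aleph0)
  have hd : Module.finrank ℂ F = 2 * n := Module.finrank_eq_of_rank_eq hr
  obtain ⟨v, hvF, h1, h2⟩ := exists_quaternionic_pairs hT F
    (by rintro _ ⟨y, rfl⟩; exact ⟨T y, (hpT y).symm⟩) n hd.ge
  have hu := orthonormal_elim_antiunitary h1 h2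
  refine ⟨_, hu, ?_, fun j => rfl⟩
  refine Submodule.eq_of_le_of_finrank_eq ?_ ?_
  · rw [Submodule.span_le]
    rintro _ ⟨j | j, rfl⟩
    · exact hvF j
    · obtain ⟨y, hy⟩ := hvF j
      exact ⟨T y, by simpa [← hy] using (hpT y).symm⟩
  · rw [finrank_span_eq_card hu.linearIndependent, hd]
    simp [two_mul]

end Basis

end

section

open Complex selfAdjoint Matrix
open scoped Real InnerProductSpace

/-! ### Continuous phases. -/

section Phase

/-- Lifting through the covering of the circle by the line. -/
lemma exists_phase {X : Type*} [TopologicalSpace X] [SimplyConnectedSpace X]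
    [LocallyPathConnectedSpace X] (x₀ : X) {f : X → ℂ} (hf : Continuous f) (h : ∀ x, ‖f x‖ = 1) :
    ∃ ψ : X → ℝ, Continuous ψ ∧ ∀ x, f x = cexp (I * ψ x) := by
  let F : C(X, Circle) := ⟨fun x => ⟨f x, mem_sphere_zero_iff_norm.mpr (h x)⟩, hf.subtype_mk _⟩
  obtain ⟨ψ, ⟨-, hψ⟩, -⟩ := Circle.isCoveringMap_exp.existsUnique_continuousMap_lifts F x₀
    (F x₀ : ℂ).arg (Circle.exp_arg _)
  refine ⟨ψ, ψ.continuous, fun x => ?_⟩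
  have := congrArg Subtype.val (congrFun hψ x)
  simp only [Function.comp_apply] at this
  rw [mul_comm, ← Circle.coe_exp]
  exact this.symm

/-- A connected image inside a countable, hence totally disconnected, set is a point. -/
lemma eq_of_forall_int {X : Type*} [TopologicalSpace X] {s : Set X} (hs : IsPreconnected s)
    {f : X → ℝ} (hf : ContinuousOn f s) (h : ∀ x ∈ s, ∃ m : ℤ, f x = 2 * π * m) {x y : X}
    (hx : x ∈ s) (hy : y ∈ s) : f x = f y := by
  have hS : (Set.range fun m : ℤ => 2 * π * m).Countable := Set.countable_range _
  have hsub : f '' s ⊆ Set.range fun m : ℤ => 2 * π * m := by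
    rintro _ ⟨z, hz, rfl⟩
    obtain ⟨m, hm⟩ := h z hz
    exact ⟨m, hm.symm⟩
  exact hS.isTotallyDisconnected _ hsub (hs.image f hf) ⟨x, hx, rfl⟩ ⟨y, hy, rfl⟩

lemma cexp_I_mul_eq_iff {a b : ℝ} : cexp (I * a) = cexp (I * b) ↔ ∃ m : ℤ, a = b + 2 * π * m := by
  rw [Complex.exp_eq_exp_iff_exists_int]
  refine exists_congr fun m => ?_
  have e : I * (b : ℂ) + m * (2 * π * I) = I * ((b + 2 * π * m : ℝ) : ℂ) := by
    push_cast
    ring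
  rw [e, mul_right_inj' I_ne_zero, Complex.ofReal_inj]

lemma norm_det_of_mem_unitaryGroup {ι : Type*} [Fintype ι] [DecidableEq ι] {M : Matrix ι ι ℂ}
    (hM : M ∈ Matrix.unitaryGroup ι ℂ) : ‖M.det‖ = 1 :=
  CStarRing.norm_of_mem_unitary (Matrix.det_of_mem_unitary hM)

lemma exists_det_eq_exp {ι : Type*} [Fintype ι] [DecidableEq ι] {M : Matrix ι ι ℂ}
    (hM : M ∈ Matrix.unitaryGroup ι ℂ) : ∃ r : ℝ, M.det = cexp (I * r) := by
  refine ⟨M.det.arg, ?_⟩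
  have := Complex.norm_mul_exp_arg_mul_I M.det
  rw [norm_det_of_mem_unitaryGroup hM, Complex.ofReal_one, one_mul] at this
  rw [mul_comm, this]

lemma continuous_transition {H : Type*} [NormedAddCommGroup H] [InnerProductSpace ℂ H]
    {Y ι : Type*} [TopologicalSpace Y] {e f : Y → ι → H} (he : Continuous e) (hf : Continuous f) :
    Continuous fun y => transition (e y) (f y) :=
  continuous_matrix fun j a =>
    ((continuous_apply a).comp he).inner ((continuous_apply j).comp hf)

end Phase

/-! ### Existence of the choices. -/

section Existence

variable {H : Type*} [NormedAddCommGroup H] [InnerProductSpace ℂ H] [CompleteSpace H]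
  {T : H ≃ₗᵢ⋆[ℂ] H} {n : ℕ}

/-- Self-dual factorization of the matching matrix at a fixed point of the involution. -/
lemma exists_selfdual_factor (hT : ∀ x, T (T x) = -x) {p : H →L[ℂ] H} (hp : IsStarProjection p)
    {u : Fin n ⊕ Fin n → H} (hu : Orthonormal ℂ u)
    (hs : Submodule.span ℂ (Set.range u) = LinearMap.range (p : H →ₗ[ℂ] H))
    (huT : ∀ j, u (Sum.inr j) = T (u (Sum.inl j))) {X Y : unitary (H →L[ℂ] H)} {q : H →L[ℂ] H}
    (hX : q * X = X * p) (hY : q * Y = Y * p) (hXY : conjT T X = Y)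
    (hF : IsFiniteRank (((X⁻¹ * Y : unitary (H →L[ℂ] H)) : H →L[ℂ] H) - 1)) :
    ∃ γ ∈ Matrix.unitaryGroup (Fin n ⊕ Fin n) ℂ,
      transition (fun j => (X : H →L[ℂ] H) (u j)) (fun j => (Y : H →L[ℂ] H) (u j)) =
        symplecticJ n * γᵀ * (symplecticJ n)⁻¹ * γ := by
  set Z : unitary (H →L[ℂ] H) := X⁻¹ * Y with hZ
  have hYX : conjT T Y = X := by
    rw [← hXY]
    ext x
    simp only [conjT_apply]
    have h1 : ∀ x, T.symm x = -T x := fun x =>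
      T.injective (by rw [T.apply_symm_apply, map_neg, hT, neg_neg])
    simp [h1, hT]
  have hZT : conjT T Z = star (Z : H →L[ℂ] H) := by
    rw [hZ, ← Unitary.coe_star, star_mul, ← Unitary.star_eq_inv, star_star, Submonoid.coe_mul,
      map_mul, hYX, Unitary.coe_star, map_star, hXY, Submonoid.coe_mul, Unitary.coe_star]
  have hZp : p * Z = Z * p := by
    rw [hZ, Submonoid.coe_mul, ← mul_assoc, inv_mul_of_mul_eq hX, mul_assoc, hY, mul_assoc]
  obtain ⟨L, hL1, hLT, hLp⟩ := exists_log T Z hF hZT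
  -- The square root `B` of `Z = X⁻¹Y` satisfies `T B = B⁻¹ T` and preserves the range of `p`; its
  -- matrix is the required `γ`.
  set B := rotor L (1 / 2) with hB
  have hBB : B * B = Z := by rw [hB, ← rotor_add, ← hL1]; norm_num
  have hBp := hLp p hp hZp (1 / 2)
  have hBi : rotor L (-(1 / 2)) = B⁻¹ := by rw [rotor_neg, Unitary.star_eq_inv]
  have hBu := apply_of_intertwines hp hBp hs
  have hE : Expands u fun j => (B : H →L[ℂ] H) (u j) := by
    have := expands_of_intertwines (X := 1) (q := p) hp (by simp) hu hs hBu
    simpa only [OneMemClass.coe_one, one_apply_eq_self] using this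
  set γ := transition u fun j => (B : H →L[ℂ] H) (u j) with hγ
  refine ⟨γ, transition_mem_unitaryGroup (orthonormal_unitary hu B) hE, ?_⟩
  have hpart : Partner T u u := ⟨fun j => (huT j).symm, fun j => by rw [huT, hT]⟩
  have hTB : ∀ x, T ((B : H →L[ℂ] H) x) = ((B⁻¹ : unitary (H →L[ℂ] H)) : H →L[ℂ] H) (T x) := by
    rw [← conjT_eq_iff, hLT, hBi]
  have hpartB : Partner T (fun j => (B : H →L[ℂ] H) (u j))
      fun j => ((B⁻¹ : unitary (H →L[ℂ] H)) : H →L[ℂ] H) (u j) :=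
    ⟨fun j => by rw [hTB, hpart.1], fun j => by rw [hTB, hpart.2, map_neg]⟩
  have h1 := hpart.transition hpartB
  have h2 : transition u (fun j => ((B⁻¹ : unitary (H →L[ℂ] H)) : H →L[ℂ] H) (u j)) = γᴴ := by
    rw [hγ, conjTranspose_transition, ← transition_unitary _ _ B]
    simp only [unitary_apply_inv_apply]
  rw [h2, ← hγ] at h1
  -- Self-duality of `γ`; hence `J γᵀ J⁻¹ γ = γ²`, the matrix of `B² = Z`.
  have h3 : symplecticJ n * γᵀ = γ * symplecticJ n := by
    have := congrArg (fun M => M.map (starRingEnd ℂ)) h1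
    simp only [Matrix.map_mul, symplecticJ_map_conj] at this
    convert this using 2
    · ext i j; simp
    · ext i j; simp
  have h4 : transition (fun j => (X : H →L[ℂ] H) (u j)) (fun j => (Y : H →L[ℂ] H) (u j)) =
      transition u fun j => (Z : H →L[ℂ] H) (u j) := by
    rw [← transition_unitary u _ X]
    congr 1
    ext j
    rw [← mul_apply_eq_comp, ← Submonoid.coe_mul, hZ, mul_inv_cancel_left]
  have h5 : transition (fun j => (B : H →L[ℂ] H) (u j)) (fun j => (Z : H →L[ℂ] H) (u j)) = γ := by
    rw [hγ, ← transition_unitary u _ B]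
    congr 1
    ext j
    rw [← mul_apply_eq_comp, ← Submonoid.coe_mul, hBB]
  have hE2 : Expands (fun j => (B : H →L[ℂ] H) (u j)) fun j => (Z : H →L[ℂ] H) (u j) :=
    expands_of_intertwines hp hBp hu hs (apply_of_intertwines hp hZp hs)
  rw [h3, symplecticJ_inv, mul_assoc γ, mul_neg, symplecticJ_mul_self, neg_neg, mul_one, h4,
    ← transition_mul hE2, h5]

/-- The construction of the invariant can be carried out. -/
lemma IsTRSymmetric.nonempty_deltaChoice (hT : ∀ x, T (T x) = -x) {P : Torus2 → H →L[ℂ] H}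
    (hP : IsTRSymmetric T (2 * n) P) : Nonempty (DeltaChoice T n P) := by
  have hπ := Real.pi_pos
  have hmp : π ∈ Set.Icc (-π) π := ⟨by linarith, le_rfl⟩
  have hmn : -π ∈ Set.Icc (-π) π := ⟨le_rfl, by linarith⟩
  obtain ⟨U, hUc, hUi, hUs, hUF⟩ := hP.exists_frame
  have hp := hP.isStarProjection (0, 0)
  obtain ⟨u, hu, hs, huT⟩ := exists_quaternionic_basis hT (hP.mem_proj (0, 0))
    (fun x => by simpa using hP.symm (0, 0) x)
  have hUn : ∀ k, P ((π : Real.Angle), k) * U (-π) k = U (-π) k * P (0, 0) := fun k => by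
    rw [← hUi (-π) hmn k, coe_neg_pi_eq]
  set α : Real.Angle → Matrix (Fin n ⊕ Fin n) (Fin n ⊕ Fin n) ℂ := fun k =>
    transition (fun j => (U π k : H →L[ℂ] H) (u j)) fun j => (U (-π) k : H →L[ℂ] H) (u j) with hα
  have hE : ∀ k, Expands (fun j => (U π k : H →L[ℂ] H) (u j))
      fun j => (U (-π) k : H →L[ℂ] H) (u j) := fun k =>
    expands_of_intertwines hp (hUi π hmp k) hu hs (apply_of_intertwines hp (hUn k) hs)
  have hcont : ∀ t ∈ Set.Icc (-π) π, Continuous fun k => fun j => (U t k : H →L[ℂ] H) (u j) := by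
    intro t ht
    have h1 : Continuous fun k : Real.Angle => U t k :=
      hUc.comp_continuous (f := fun k : Real.Angle => (t, k)) (by fun_prop)
        fun k => ⟨ht, trivial⟩
    exact continuous_pi fun j =>
      (continuous_subtype_val.comp h1).clm_apply continuous_const
  have hαc : Continuous α := continuous_transition (hcont _ hmp) (hcont _ hmn)
  have hαu : ∀ k, α k ∈ Matrix.unitaryGroup (Fin n ⊕ Fin n) ℂ := fun k =>
    transition_mem_unitaryGroup (orthonormal_unitary hu _) (hE k)
  have hγ : ∀ k : Real.Angle, -k = k → ∃ γ ∈ Matrix.unitaryGroup (Fin n ⊕ Fin n) ℂ,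
      α k = symplecticJ n * γᵀ * (symplecticJ n)⁻¹ * γ := fun k hk =>
    exists_selfdual_factor hT hp hu hs huT (hUi π hmp k) (hUn k)
      (by rw [hUs π hmp, hk]) (hUF k)
  obtain ⟨γ₀, hγ₀, hα₀⟩ := hγ 0 neg_zero
  obtain ⟨γπ, hγπ, hαπ⟩ := hγ (π : ℝ) (by simp)
  obtain ⟨lam₀, hlam₀⟩ := exists_det_eq_exp hγ₀
  obtain ⟨lamπ, hlamπ⟩ := exists_det_eq_exp hγπ
  obtain ⟨μ, hμc, hμ⟩ := exists_phase (0 : ℝ)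
    (f := fun k : ℝ => (α (k : Real.Angle)).det)
    ((hαc.comp Real.Angle.continuous_coe).matrix_det)
    fun k => norm_det_of_mem_unitaryGroup (hαu _)
  have h0 : cexp (I * μ 0) = cexp (I * (2 * lam₀ : ℝ)) := by
    rw [← hμ 0, Real.Angle.coe_zero, hα₀, det_selfdual_factor, hlam₀, ← Complex.exp_nat_mul]
    congr 1
    push_cast
    ring
  -- Any lift agrees with `2λ₀` at `0` up to `2πm`; subtracting this constant normalises it.
  obtain ⟨m, hm⟩ := cexp_I_mul_eq_iff.mp h0
  exact ⟨{
    U := U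
    continuousOn_U := hUc
    intertwines := hUi
    symm := fun t ht k => (conjT_eq_iff _ _ _).mp (hUs t ht k)
    u := u
    orthonormal := hu
    span_u := hs
    u_inr := huT
    α := α
    matching := hE
    γ₀ := γ₀
    γπ := γπ
    γ₀_unitary := hγ₀
    γπ_unitary := hγπ
    α_zero := hα₀
    α_pi := hαπ
    lam₀ := lam₀
    lamπ := lamπ
    det_γ₀ := hlam₀
    det_γπ := hlamπ
    μ := fun k => μ k - 2 * π * m
    continuousOn_μ := (hμc.sub continuous_const).continuousOn
    det_α := fun k _ => by
      rw [hμ, cexp_I_mul_eq_iff]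
      exact ⟨m, by ring⟩
    μ_zero := by rw [hm]; ring }⟩

end Existence

end

section

open Complex selfAdjoint Matrix
open scoped Real InnerProductSpace

/-! ### Independence of the choices and invariance under equivalence. -/

section Independence

variable {H : Type*} [NormedAddCommGroup H] [InnerProductSpace ℂ H] [CompleteSpace H]
  {T : H ≃ₗᵢ⋆[ℂ] H} {n : ℕ} {P : Torus2 → H →L[ℂ] H}

namespace DeltaChoice

/-- The moving frame `u_j(t,k) = U(t,k) u_j`. -/
def frame (D : DeltaChoice T n P) (t : ℝ) (k : Real.Angle) (j : Fin n ⊕ Fin n) : H :=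
  (D.U t k : H →L[ℂ] H) (D.u j)

variable (D D' : DeltaChoice T n P)

lemma orthonormal_frame (t : ℝ) (k : Real.Angle) : Orthonormal ℂ (D.frame t k) :=
  orthonormal_unitary D.orthonormal _

lemma expands_frame (hp : IsStarProjection (P (0, 0))) {t s : ℝ} (ht : t ∈ Set.Icc (-π) π)
    (hs : s ∈ Set.Icc (-π) π) (hts : (s : Real.Angle) = t) (k : Real.Angle) :
    Expands (D.frame t k) (D'.frame s k) :=
  expands_of_intertwines hp (D.intertwines t ht k) D.orthonormal D.span_u
    (hts ▸ apply_of_intertwines hp (D'.intertwines s hs k) D'.span_u)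

lemma partner_frame (hT : ∀ x, T (T x) = -x) {t : ℝ} (ht : t ∈ Set.Icc (-π) π) (k : Real.Angle) :
    Partner T (D.frame t k) (D.frame (-t) (-k)) :=
  ⟨fun j => by rw [frame, D.symm t ht, frame, D.u_inr],
    fun j => by rw [frame, D.symm t ht, frame, D.u_inr, hT, map_neg]⟩

lemma α_eq (k : Real.Angle) : D.α k = transition (D.frame π k) (D.frame (-π) k) :=
  eq_transition (D.orthonormal_frame π k) (D.matching k)

lemma continuousOn_frame : ContinuousOn (fun q : ℝ × Real.Angle => D.frame q.1 q.2)
    (Set.Icc (-π) π ×ˢ Set.univ) :=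
  continuousOn_pi.mpr fun _ =>
    (continuous_subtype_val.comp_continuousOn D.continuousOn_U).clm_apply continuousOn_const

/-- Every value of the construction is a sign. -/
lemma value_eq : D.value = 1 ∨ D.value = -1 := by
  rw [← sq_eq_one_iff]
  have h1 := D.det_α π ⟨Real.pi_pos.le, le_rfl⟩
  rw [D.α_pi, det_selfdual_factor, D.det_γπ, ← Complex.exp_nat_mul] at h1
  rw [value, ← Complex.exp_nat_mul]
  have e : (2 : ℕ) * (I * ((2 * (D.lamπ : ℂ) - D.μ π) / 2)) =
      (2 : ℕ) * (I * D.lamπ) - I * D.μ π := by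
    push_cast
    ring
  rw [e, Complex.exp_sub, h1, div_self (Complex.exp_ne_zero _)]

/-- The construction does not depend on the choices. -/
lemma value_unique (hT : ∀ x, T (T x) = -x) (hp : IsStarProjection (P (0, 0))) :
    D'.value = D.value := by
  have hπ := Real.pi_pos
  have hmp : π ∈ Set.Icc (-π) π := ⟨by linarith, le_rfl⟩
  have hmn : -π ∈ Set.Icc (-π) π := ⟨le_rfl, by linarith⟩
  have hm0 : (0 : ℝ) ∈ Set.Icc (-π) π := ⟨by linarith, hπ.le⟩
  set G : ℝ → Real.Angle → Matrix (Fin n ⊕ Fin n) (Fin n ⊕ Fin n) ℂ := fun t k =>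
    transition (D.frame t k) (D'.frame t k) with hG
  have hGu : ∀ t ∈ Set.Icc (-π) π, ∀ k, G t k ∈ Matrix.unitaryGroup (Fin n ⊕ Fin n) ℂ :=
    fun t ht k => transition_mem_unitaryGroup (D'.orthonormal_frame t k)
      (D.expands_frame D' hp ht ht rfl k)
  have hGα : ∀ k, D'.α k * G π k = G (-π) k * D.α k := fun k => by
    rw [D.α_eq, D'.α_eq, hG,
      transition_mul (D'.expands_frame D' hp hmp hmn coe_neg_pi_eq k),
      transition_mul (D.expands_frame D' hp hmn hmn rfl k)]
  have hGT : ∀ t ∈ Set.Icc (-π) π, ∀ k, symplecticJ n * G (-t) (-k) =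
      (G t k).map (starRingEnd ℂ) * symplecticJ n := fun t ht k =>
    (D.partner_frame hT ht k).transition (D'.partner_frame hT ht k)
  have hJ : (symplecticJ n).det ≠ 0 := by
    have h := congrArg Matrix.det (symplecticJ_mul_self (n := n))
    intro h0
    rw [Matrix.det_mul, h0, zero_mul, Matrix.det_neg, Matrix.det_one, mul_one] at h
    exact pow_ne_zero _ (by norm_num) h.symm
  have hGd : ∀ t ∈ Set.Icc (-π) π, ∀ k, (G (-t) (-k)).det = (starRingEnd ℂ) (G t k).det := by
    intro t ht k
    have := congrArg Matrix.det (hGT t ht k)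
    rw [Matrix.det_mul, Matrix.det_mul, mul_comm] at this
    rw [mul_right_cancel₀ hJ this, RingHom.map_det]
    rfl
  -- At a fixed point of `(t,k) ↦ (-t,-k)` with `t = 0` the change of frames is itself quaternionic.
  have hfix : ∀ k : Real.Angle, -k = k → (G 0 k).det = 1 := fun k hk => by
    have h := hGT 0 hm0 k
    rw [neg_zero, hk] at h
    exact det_eq_one_of_quaternionic (hGu 0 hm0 k) h
  -- the phase of the determinant of the change of frames
  let c : ℝ → ℝ := fun t => max (-π) (min π t)
  have hc : ∀ t, c t ∈ Set.Icc (-π) π := fun t =>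
    ⟨le_max_left _ _, max_le (by linarith) (min_le_left _ _)⟩
  have hcid : ∀ t ∈ Set.Icc (-π) π, c t = t := fun t ht => by
    simp only [c]
    rw [min_eq_right ht.2, max_eq_right ht.1]
  have hcneg : ∀ t, c (-t) = -c t := fun t => by
    simp only [c]
    rcases le_total t (-π) with h | h <;> rcases le_total t π with h' | h' <;>
      grind
  have hcc : Continuous c := by fun_prop
  have hcf : ∀ E : DeltaChoice T n P,
      Continuous fun q : ℝ × ℝ => E.frame (c q.1) (q.2 : Real.Angle) := fun E =>
    E.continuousOn_frame.comp_continuous (f := fun q : ℝ × ℝ => (c q.1, (q.2 : Real.Angle)))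
      ((hcc.comp continuous_fst).prodMk (Real.Angle.continuous_coe.comp continuous_snd))
      fun q => ⟨hc _, trivial⟩
  -- The clamp `c` is odd and the identity on `[-π,π]`; it and the universal cover in `k` put the
  -- phase on a simply connected plane.
  obtain ⟨ψ, hψc, hψ⟩ := exists_phase (0 : ℝ × ℝ)
    (f := fun q : ℝ × ℝ => (G (c q.1) (q.2 : Real.Angle)).det)
    (continuous_transition (hcf D) (hcf D')).matrix_det
    fun q => norm_det_of_mem_unitaryGroup (hGu _ (hc _) _)
  have hψ' : ∀ t ∈ Set.Icc (-π) π, ∀ k : ℝ, (G t k).det = cexp (I * ψ (t, k)) := fun t ht k => by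
    have := hψ (t, k)
    simpa only [hcid t ht] using this
  have hone : ∀ k : ℝ, -(k : Real.Angle) = k → ∃ m : ℤ, ψ (0, k) = 2 * π * m := fun k hk => by
    have h := hψ' 0 hm0 k
    rw [hfix k hk] at h
    have h2 : cexp (I * ψ (0, k)) = cexp (I * (0 : ℝ)) := by rw [← h]; simp
    obtain ⟨m, hm⟩ := cexp_I_mul_eq_iff.mp h2
    exact ⟨m, by rw [hm, zero_add]⟩
  obtain ⟨m₀, hm₀⟩ := hone 0 (by simp)
  obtain ⟨m₁, hm₁⟩ := hone π (by simp)
  -- Reflection conjugates the determinant, so the sum stays in `2πℤ` and keeps its value at the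
  -- origin, twice `2πm₀`.
  have hsym : ∀ t k : ℝ, ψ (t, k) + ψ (-t, -k) = 4 * π * m₀ := by
    intro t k
    have := eq_of_forall_int (isPreconnected_univ (α := ℝ × ℝ))
      (f := fun q => ψ q + ψ (-q)) (by fun_prop) (fun q _ => by
        have h1 := hψ (-q)
        simp only [Prod.fst_neg, Prod.snd_neg, hcneg, Real.Angle.coe_neg] at h1
        rw [hGd _ (hc _), hψ q, ← Complex.exp_conj, map_mul, conj_I, conj_ofReal] at h1
        have h2 : cexp (I * ((-ψ q : ℝ) : ℂ)) = cexp (I * ψ (-q)) := by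
          rw [← h1]; push_cast; ring_nf
        obtain ⟨m, hm⟩ := cexp_I_mul_eq_iff.mp h2
        exact ⟨-m, by push_cast; linarith⟩) (Set.mem_univ (t, k)) (Set.mem_univ (0, 0))
    simp only [Prod.neg_mk, neg_zero, hm₀] at this
    rw [this]
    ring
  -- The change around the circle does not depend on `t`; at `t = 0` the reflection symmetry makes
  -- it an even multiple of `2π`.
  have hper : ∀ t : ℝ, ψ (t, π) - ψ (t, -π) = 4 * π * (m₁ - m₀) := by
    intro t
    have := eq_of_forall_int (isPreconnected_univ (α := ℝ))
      (f := fun t => ψ (t, π) - ψ (t, -π)) (by fun_prop) (fun t _ => by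
        have h1 := hψ (t, -π)
        simp only [coe_neg_pi_eq] at h1
        rw [hψ (t, π)] at h1
        obtain ⟨m, hm⟩ := cexp_I_mul_eq_iff.mp h1
        exact ⟨m, by linarith⟩) (Set.mem_univ t) (Set.mem_univ 0)
    rw [this]
    have h2 := hsym 0 π
    rw [neg_zero] at h2
    linarith
  -- comparison of the remaining choices
  have hγ : ∀ k : ℝ, -(k : Real.Angle) = k → ∀ γ γ', γ ∈ Matrix.unitaryGroup (Fin n ⊕ Fin n) ℂ →
      D.α k = symplecticJ n * γᵀ * (symplecticJ n)⁻¹ * γ →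
      D'.α k = symplecticJ n * γ'ᵀ * (symplecticJ n)⁻¹ * γ' →
      ∀ l l' : ℝ, γ.det = cexp (I * l) → γ'.det = cexp (I * l') →
      ∃ m : ℤ, l' + ψ (π, k) = l + 2 * π * m := by
    intro k hk γ γ' hγu hα hα' l l' hl hl'
    have h1 := hGT π hmp k
    rw [hk] at h1
    have h2 := hGα k
    rw [hα, hα'] at h2
    have h3 := det_mul_eq_of_selfdual_factor hγu (hGu π hmp k) h1 h2
    rw [hl, hl', hψ' π hmp, ← Complex.exp_add] at h3
    rw [← cexp_I_mul_eq_iff, ← h3]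
    congr 1
    push_cast
    ring
  obtain ⟨a, ha⟩ := hγ 0 (by simp) _ _ D.γ₀_unitary (by simpa using D.α_zero)
    (by simpa using D'.α_zero) _ _ D.det_γ₀ D'.det_γ₀
  obtain ⟨b, hb⟩ := hγ π (by simp) _ _ D.γπ_unitary D.α_pi D'.α_pi _ _ D.det_γπ D'.det_γπ
  -- Determinants in `hGα` confine this combination of phases to `2πℤ` for every `k` in `[0,π]`, so
  -- it is constant.
  have hμ : D'.μ π + ψ (π, π) - ψ (-π, π) - D.μ π = D'.μ 0 + ψ (π, 0) - ψ (-π, 0) - D.μ 0 := by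
    refine eq_of_forall_int (isPreconnected_Icc (a := (0 : ℝ)) (b := π))
      (f := fun k => D'.μ k + ψ (π, k) - ψ (-π, k) - D.μ k) ?_ (fun k hk => ?_)
      ⟨hπ.le, le_rfl⟩ ⟨le_rfl, hπ.le⟩
    · have h1 : Continuous fun k : ℝ => ψ (π, k) := by fun_prop
      have h2 : Continuous fun k : ℝ => ψ (-π, k) := by fun_prop
      exact ((D'.continuousOn_μ.add h1.continuousOn).sub h2.continuousOn).sub D.continuousOn_μ
    · have h1 := congrArg Matrix.det (hGα k)
      rw [Matrix.det_mul, Matrix.det_mul, D.det_α k hk, D'.det_α k hk, hψ' π hmp, hψ' (-π) hmn,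
        ← Complex.exp_add, ← Complex.exp_add, ← mul_add, ← mul_add, ← Complex.ofReal_add,
        ← Complex.ofReal_add] at h1
      obtain ⟨m, hm⟩ := cexp_I_mul_eq_iff.mp h1
      exact ⟨m, by linarith⟩
  rw [D.μ_zero, D'.μ_zero] at hμ
  have h1 := hsym π 0
  have h2 := hsym π (-π)
  rw [neg_zero] at h1
  rw [neg_neg] at h2
  have h3 := hper π
  -- All corrections before halving are multiples of `4π`: from `2λ`, from `hsym` and from `hper`.
  have key : (2 * D'.lamπ - D'.μ π) / 2 =
      (2 * D.lamπ - D.μ π) / 2 + 2 * π * ((b - a + m₀ - m₁ : ℤ) : ℝ) := by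
    push_cast
    linarith
  have e : ∀ E : DeltaChoice T n P,
      E.value = cexp (I * (((2 * E.lamπ - E.μ π) / 2 : ℝ) : ℂ)) := fun E => by
    rw [value]; push_cast; rfl
  rw [e, e, cexp_I_mul_eq_iff]
  exact ⟨_, key⟩

/-- Transport of the choices along a symmetric unitary equivalence. -/
lemma exists_value_eq_of_equivalent {P₁ : Torus2 → H →L[ℂ] H}
    (h : SymmUnitarilyEquivalent T P P₁) : ∃ E : DeltaChoice T n P₁, E.value = D.value := by
  obtain ⟨V, hVc, hVT, hV⟩ := h
  have hVi : ∀ k, P₁ k * V k = V k * P k := fun k => by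
    rw [hV, mul_assoc, ← Submonoid.coe_mul, inv_mul_cancel, OneMemClass.coe_one, mul_one]
  set V₀ := V (0, 0) with hV₀
  have hV₀T : ∀ x, T ((V₀ : H →L[ℂ] H) x) = (V₀ : H →L[ℂ] H) (T x) := fun x => by
    simpa using hVT (0, 0) x
  have hVper : ∀ k : Real.Angle, V (((-π : ℝ) : Real.Angle), k) = V ((π : ℝ), k) := fun k => by
    rw [coe_neg_pi_eq]
  have hV₀i : ∀ x, T (((V₀⁻¹ : unitary (H →L[ℂ] H)) : H →L[ℂ] H) x) =
      ((V₀⁻¹ : unitary (H →L[ℂ] H)) : H →L[ℂ] H) (T x) := fun x => by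
    conv_rhs => rw [← unitary_apply_inv_apply V₀ x, hV₀T, unitary_inv_apply_apply]
  -- The factors `V₀⁻¹` and `V₀` cancel in the moving frame, which becomes `V(t,k)` applied to the
  -- old one. As `V` agrees at `t = ±π`, the matrices `α` do not change.
  refine ⟨{
    U := fun t k => V ((t : Real.Angle), k) * D.U t k * V₀⁻¹
    continuousOn_U := ?_
    intertwines := fun t ht k => ?_
    symm := fun t ht k x => ?_
    u := fun j => (V₀ : H →L[ℂ] H) (D.u j)
    orthonormal := orthonormal_unitary D.orthonormal V₀
    span_u := ?_
    u_inr := fun j => by rw [hV₀T, D.u_inr]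
    α := D.α
    matching := fun k j => ?_
    γ₀ := D.γ₀
    γπ := D.γπ
    γ₀_unitary := D.γ₀_unitary
    γπ_unitary := D.γπ_unitary
    α_zero := D.α_zero
    α_pi := D.α_pi
    lam₀ := D.lam₀
    lamπ := D.lamπ
    det_γ₀ := D.det_γ₀
    det_γπ := D.det_γπ
    μ := D.μ
    continuousOn_μ := D.continuousOn_μ
    det_α := D.det_α
    μ_zero := D.μ_zero }, rfl⟩
  · have h1 : Continuous fun q : ℝ × Real.Angle => V ((q.1 : Real.Angle), q.2) :=
      hVc.comp ((Real.Angle.continuous_coe.comp continuous_fst).prodMk continuous_snd)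
    exact (h1.continuousOn.mul D.continuousOn_U).mul continuousOn_const
  · rw [Submonoid.coe_mul, Submonoid.coe_mul, ← mul_assoc, ← mul_assoc, hVi,
      mul_assoc (V ((t : Real.Angle), k) : H →L[ℂ] H), D.intertwines t ht k]
    simp only [mul_assoc]
    rw [inv_mul_of_mul_eq (hVi (0, 0))]
  · simp only [Submonoid.coe_mul, mul_apply_eq_comp]
    rw [hVT, D.symm t ht, hV₀i]
    simp
  · have hr : Set.range (fun j => (V₀ : H →L[ℂ] H) (D.u j)) =
        ((V₀ : H →L[ℂ] H) : H →ₗ[ℂ] H) '' Set.range D.u := by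
      rw [← Set.range_comp]; rfl
    have hVx : ∀ x, P₁ (0, 0) ((V₀ : H →L[ℂ] H) x) = (V₀ : H →L[ℂ] H) (P (0, 0) x) := fun x =>
      congrArg (fun Z : H →L[ℂ] H => Z x) (hVi (0, 0))
    rw [hr, ← Submodule.map_span, D.span_u]
    ext y
    constructor
    · rintro ⟨_, ⟨x, rfl⟩, rfl⟩
      exact ⟨(V₀ : H →L[ℂ] H) x, hVx x⟩
    · rintro ⟨x, rfl⟩
      refine ⟨_, ⟨((V₀⁻¹ : unitary (H →L[ℂ] H)) : H →L[ℂ] H) x, rfl⟩, ?_⟩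
      have := hVx (((V₀⁻¹ : unitary (H →L[ℂ] H)) : H →L[ℂ] H) x)
      rw [unitary_apply_inv_apply] at this
      exact this.symm
  · simp only [Submonoid.coe_mul, mul_apply_eq_comp, unitary_inv_apply_apply]
    rw [D.matching, map_sum, hVper]
    simp only [map_smul]

lemma delta_eq (hT : ∀ x, T (T x) = -x) (hp : IsStarProjection (P (0, 0))) :
    delta T n P = D.value := by
  rw [delta, dif_pos ⟨D⟩]
  exact value_unique _ _ hT hp

end DeltaChoice

lemma IsTRSymmetric.deltaValues_eq (hT : ∀ x, T (T x) = -x) (hP : IsTRSymmetric T (2 * n) P) :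
    deltaValues T n P = {delta T n P} := by
  obtain ⟨D⟩ := hP.nonempty_deltaChoice hT
  ext z
  rw [Set.mem_singleton_iff]
  constructor
  · rintro ⟨E, rfl⟩
    exact (E.delta_eq hT (hP.isStarProjection _)).symm
  · rintro rfl
    exact ⟨D, (D.delta_eq hT (hP.isStarProjection _)).symm⟩

end Independence

end

end TimeReversal

end

theorem mainTheorem4 {H : Type*} [NormedAddCommGroup H] [InnerProductSpace ℂ H] [CompleteSpace H]
    (T : H ≃ₗᵢ⋆[ℂ] H) (hT : ∀ x, T (T x) = -x) (n : ℕ)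
    (P₀ P₁ : TimeReversal.Torus2 → H →L[ℂ] H)
    (hP₀ : TimeReversal.IsTRSymmetric T (2 * n) P₀)
    (hP₁ : TimeReversal.IsTRSymmetric T (2 * n) P₁)
    (h : TimeReversal.SymmUnitarilyEquivalent T P₀ P₁ ∨
      TimeReversal.SymmHomotopic T (2 * n) P₀ P₁) :
    TimeReversal.deltaValues T n P₀ = {TimeReversal.delta T n P₀} ∧
    TimeReversal.deltaValues T n P₁ = {TimeReversal.delta T n P₁} ∧
    (TimeReversal.delta T n P₀ = 1 ∨ TimeReversal.delta T n P₀ = -1) ∧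
    TimeReversal.delta T n P₀ = TimeReversal.delta T n P₁ := by
  have hE : TimeReversal.SymmUnitarilyEquivalent T P₀ P₁ :=
    h.elim id TimeReversal.SymmHomotopic.symmUnitarilyEquivalent
  obtain ⟨D⟩ := hP₀.nonempty_deltaChoice hT
  obtain ⟨E, hED⟩ := D.exists_value_eq_of_equivalent hE
  have hD := D.delta_eq hT (hP₀.isStarProjection _)
  have hE' := E.delta_eq hT (hP₁.isStarProjection _)
  exact ⟨hP₀.deltaValues_eq hT, hP₁.deltaValues_eq hT, hD ▸ D.value_eq, by rw [hD, hE', hED]⟩
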